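/- Let $\Bbbk$ be an algebraically closed field of characteristic $p>0$. Let $\Bbbk \subset K \subset L$ be fields, finitely generated over $\Bbbk$, such that the extension $L/K$ is inseparable (i.e. not separably generated: there is no transcendence basis $s$ of $L/K$ such that $L/K(s)$ is separable algebraic) and $\mathrm{tr.deg}_{\Bbbk} K \geq 1$. Put $n=\mathrm{tr.deg}_{\Bbbk} L$, and let $N>n$ be an integer. Let $\delta_{L/K}:\Omega_{K/\Bbbk}\otimes_K L\to\Omega_{L/\Bbbk}$ be the natural $L$-linear map, and assume that $p\geq 3$ or that the rank of $\delta_{L/K}$ is even. Then there exists an $n$-dimensional projective variety $X\subset\mathbb{P}^N$ over $\Bbbk$, non-degenerate (not contained in any hyperplane), with an isomorphism $K(X)\cong L$ over $\Bbbk$ under which the extension $K(X)/K(\gamma_X(X))$ induced by the Gauss map $\gamma_X$ coincides with $L/K$, i.e. the subfield $\gamma_X^*K(\gamma_X(X))\subset K(X)$ corresponds to $K\subset L$. Here $\gamma_X: X\dashrightarrow\mathbb{G}(n,\mathbb{P}^N)$ is the rational map sending each smooth point $x$ of $X$ to the embedded tangent space $\mathbb{T}_xX\subset\mathbb{P}^N$,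 and $K(\gamma_X(X))$ is the function field of the closure of its image. -/

import Mathlib

open MvPolynomial
open scoped LinearAlgebra.Projectivization

attribute [local instance] MvPolynomial.gradedAlgebra

/-- A field extension `L / K` is separably generated if `L` is separable algebraic over
`K(s)` for some transcendence basis `s` of `L / K`. For finitely generated extensions this is
the usual notion of a separable (not necessarily algebraic) extension. -/
def IsSeparablyGenerated (K L : Type*) [Field K] [Field L] [Algebra K L] : Prop :=
  ∃ s : Set L, IsTranscendenceBasis K ((↑) : s → L) ∧
    Algebra.IsSeparable (IntermediateField.adjoin K s) L

/-- The `L`-linear map `δ_{L/K} : L ⊗_K Ω_{K/k} → Ω_{L/k}` has rank `deltaRank k K L`. -/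
noncomputable def deltaRank (k K L : Type*) [Field k] [Field K] [Field L]
    [Algebra k K] [Algebra K L] [Algebra k L] [IsScalarTower k K L] : ℕ :=
  Module.finrank L (LinearMap.range (KaehlerDifferential.mapBaseChange k K L))

/-- A projective variety in `ℙ^N` over `k` (algebraically closed in the applications), given by
its homogeneous prime ideal, which is not allowed to contain the irrelevant ideal. -/
structure ProjectiveVariety (k : Type*) [Field k] (N : ℕ) where
  /-- The homogeneous ideal `I(X)`. -/
  ideal : Ideal (MvPolynomial (Fin (N + 1)) k)
  isHomogeneous : ideal.IsHomogeneous (homogeneousSubmodule (Fin (N + 1)) k)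
  isPrime : ideal.IsPrime
  not_irrelevant : ∃ i, (MvPolynomial.X i : MvPolynomial (Fin (N + 1)) k) ∉ ideal

/-- The set of points of the Grassmannian `𝔾(r - 1, ℙ^N)`: the `(r - 1)`-dimensional linear
subvarieties of `ℙ^N`, i.e. the `r`-dimensional subspaces of `k^(N+1)`. -/
def ProjGrassmannian (k : Type*) [Field k] (N r : ℕ) : Type _ :=
  {W : Submodule k (Fin (N + 1) → k) // Module.finrank k W = r}

/-- The Plücker coordinates of an `r`-dimensional subspace `W`: the `r × r` minors (indexed by
all sequences of `r` columns) of a matrix whose rows form a basis of `W`. Another basis changes all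
of them by a common nonzero factor. -/
noncomputable def ProjGrassmannian.plucker {k : Type*} [Field k] {N r : ℕ}
    (W : ProjGrassmannian k N r) (I : Fin r → Fin (N + 1)) : k :=
  Matrix.det (Matrix.of fun a b : Fin r =>
    ((Module.finBasisOfFinrankEq k W.1 W.2 a : W.1) : Fin (N + 1) → k) (I b))

namespace ProjectiveVariety

variable {k : Type*} [Field k] {N : ℕ} (X : ProjectiveVariety k N)

instance : X.ideal.IsPrime := X.isPrime

/-- The homogeneous coordinate ring of `X`. -/
abbrev CoordRing : Type _ := MvPolynomial (Fin (N + 1)) k ⧸ X.ideal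

/-- The class of a polynomial in the fraction field of the homogeneous coordinate ring. -/
noncomputable def toFrac : MvPolynomial (Fin (N + 1)) k →ₐ[k] FractionRing X.CoordRing :=
  (IsScalarTower.toAlgHom k X.CoordRing (FractionRing X.CoordRing)).comp
    (Ideal.Quotient.mkₐ k X.ideal)

theorem toFrac_eq_zero_iff (F : MvPolynomial (Fin (N + 1)) k) :
    X.toFrac F = 0 ↔ F ∈ X.ideal := by
  have h : X.toFrac F = algebraMap X.CoordRing (FractionRing X.CoordRing)
      (Ideal.Quotient.mk X.ideal F) := rfl
  rw [h, IsFractionRing.to_map_eq_zero_iff, Ideal.Quotient.eq_zero_iff_mem]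

/-- The function field `K(X)`: the fractions `A / B` of homogeneous elements of the same degree of
the homogeneous coordinate ring. -/
noncomputable def functionField : IntermediateField k (FractionRing X.CoordRing) where
  carrier := {h | ∃ (d : ℕ) (A B : MvPolynomial (Fin (N + 1)) k),
    A.IsHomogeneous d ∧ B.IsHomogeneous d ∧ B ∉ X.ideal ∧ h = X.toFrac A / X.toFrac B}
  mul_mem' := by
    rintro _ _ ⟨d, A, B, hA, hB, hB0, rfl⟩ ⟨e, A', B', hA', hB', hB0', rfl⟩
    refine ⟨d + e, A * A', B * B', hA.mul hA', hB.mul hB', fun h => ?_, ?_⟩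
    · exact (X.isPrime.mem_or_mem h).elim hB0 hB0'
    · rw [map_mul, map_mul, div_mul_div_comm]
  add_mem' := by
    rintro _ _ ⟨d, A, B, hA, hB, hB0, rfl⟩ ⟨e, A', B', hA', hB', hB0', rfl⟩
    refine ⟨d + e, A * B' + B * A', B * B', (hA.mul hB').add (hB.mul hA'), hB.mul hB',
      fun h => ?_, ?_⟩
    · exact (X.isPrime.mem_or_mem h).elim hB0 hB0'
    · rw [map_add, map_mul, map_mul, map_mul,
        div_add_div _ _ (mt (X.toFrac_eq_zero_iff B).1 hB0) (mt (X.toFrac_eq_zero_iff B').1 hB0')]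
  algebraMap_mem' := fun c => by
    refine ⟨0, C c, 1, isHomogeneous_C _ _, isHomogeneous_one _ _, fun h => ?_, ?_⟩
    · exact X.isPrime.ne_top ((Ideal.eq_top_iff_one _).2 h)
    · rw [map_one, div_one, ← MvPolynomial.algebraMap_eq, AlgHom.commutes]
  inv_mem' := by
    rintro _ ⟨d, A, B, hA, hB, hB0, rfl⟩
    by_cases hA0 : A ∈ X.ideal
    · refine ⟨d, 0, B, isHomogeneous_zero _ _ _, hB, hB0, ?_⟩
      rw [(X.toFrac_eq_zero_iff A).2 hA0, map_zero, zero_div, inv_zero]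
    · exact ⟨d, B, A, hB, hA, hA0, inv_div _ _⟩

/-- The dimension of `X`, i.e. the transcendence degree of its function field. -/
noncomputable def dim : ℕ := Cardinal.toNat (Algebra.trdeg k X.functionField)

/-- The set of (closed) points of `X`. -/
def points : Set (ℙ k (Fin (N + 1) → k)) :=
  {x | ∀ F ∈ X.ideal, eval x.rep F = 0}

/-- `X` is non-degenerate if no hyperplane of `ℙ^N` contains it. -/
def IsNondegenerate : Prop :=
  ¬ ∃ c : Fin (N + 1) → k, c ≠ 0 ∧ ∀ x ∈ X.points, ∑ i, c i * x.rep i = 0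

/-- The embedded tangent space `𝕋_x X` to `X` at `x`, as a subspace of `k^(N+1)`: the common zeros
of the linear forms `∑ j, (∂F/∂X_j)(x) X_j` with `F` in the ideal of `X`. -/
noncomputable def tangentSpace (x : ℙ k (Fin (N + 1) → k)) :
    Submodule k (Fin (N + 1) → k) where
  carrier := {v | ∀ F ∈ X.ideal, ∑ j, eval x.rep (pderiv j F) * v j = 0}
  add_mem' := fun {v w} hv hw F hF => by
    simp only [Pi.add_apply, mul_add, Finset.sum_add_distrib, hv F hF, hw F hF, add_zero]
  zero_mem' := fun F _ => by simp
  smul_mem' := fun c v hv F hF => by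
    simp only [Pi.smul_apply, smul_eq_mul, mul_left_comm _ c, ← Finset.mul_sum, hv F hF, mul_zero]

/-- Smooth points, by the Jacobian criterion: `dim 𝕋_x X = dim X` as a projective space. -/
def IsSmoothAt (x : ℙ k (Fin (N + 1) → k)) : Prop :=
  x ∈ X.points ∧ Module.finrank k (X.tangentSpace x) = X.dim + 1

/-- The Gauss map `γ_X`, which maps a smooth point `x` of `X` to the embedded tangent space
`𝕋_x X`, a point of `𝔾(dim X, ℙ^N)`. -/
noncomputable def gaussMap (x : {x // X.IsSmoothAt x}) : ProjGrassmannian k N (X.dim + 1) :=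
  ⟨X.tangentSpace x.1, x.2.2⟩

/-- The rational function `h` on `X` is regular at the point `x` of `X`, with value `c` there. -/
def HasValue (h : FractionRing X.CoordRing) (x : ℙ k (Fin (N + 1) → k)) (c : k) : Prop :=
  ∃ (d : ℕ) (A B : MvPolynomial (Fin (N + 1)) k), A.IsHomogeneous d ∧ B.IsHomogeneous d ∧
    eval x.rep B ≠ 0 ∧ h = X.toFrac A / X.toFrac B ∧ c = eval x.rep A / eval x.rep B

/-- The rational function `h` on `X` is the pull-back under the Gauss map of a rational function on
the closure of `γ_X(X)`. The latter is a quotient `G / H` of homogeneous polynomials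
of the same degree in the Plücker coordinates, such that `H` does not vanish identically on
`γ_X(X)`; and `h` agrees with `(G / H) ∘ γ_X` on a nonempty open subset
`{x smooth | D(x) ≠ 0}` of `X`. -/
def IsGaussPullback (h : FractionRing X.CoordRing) : Prop :=
  ∃ (d : ℕ) (G H : MvPolynomial (Fin (X.dim + 1) → Fin (N + 1)) k),
    G.IsHomogeneous d ∧ H.IsHomogeneous d ∧
    ∃ (e : ℕ) (D : MvPolynomial (Fin (N + 1)) k), D.IsHomogeneous e ∧ D ∉ X.ideal ∧
      ∀ x : {x // X.IsSmoothAt x}, eval x.1.rep D ≠ 0 →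
        eval (X.gaussMap x).plucker H ≠ 0 ∧
        X.HasValue h x.1 (eval (X.gaussMap x).plucker G / eval (X.gaussMap x).plucker H)

variable {X}

theorem notMem_of_eval_ne_zero {x : ℙ k (Fin (N + 1) → k)} (hx : x ∈ X.points)
    {B : MvPolynomial (Fin (N + 1)) k} (hB : eval x.rep B ≠ 0) : B ∉ X.ideal :=
  fun h => hB (hx B h)

theorem HasValue.add {h h' : FractionRing X.CoordRing} {x : ℙ k (Fin (N + 1) → k)} {c c' : k}
    (hx : x ∈ X.points) (H : X.HasValue h x c) (H' : X.HasValue h' x c') :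
    X.HasValue (h + h') x (c + c') := by
  obtain ⟨d, A, B, hA, hB, hB0, rfl, rfl⟩ := H
  obtain ⟨e, A', B', hA', hB', hB0', rfl, rfl⟩ := H'
  refine ⟨d + e, A * B' + B * A', B * B', (hA.mul hB').add (hB.mul hA'), hB.mul hB', ?_, ?_, ?_⟩
  · rw [map_mul]; exact mul_ne_zero hB0 hB0'
  · rw [map_add, map_mul, map_mul, map_mul,
      div_add_div _ _ (mt (X.toFrac_eq_zero_iff B).1 (notMem_of_eval_ne_zero hx hB0))
        (mt (X.toFrac_eq_zero_iff B').1 (notMem_of_eval_ne_zero hx hB0'))]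
  · rw [map_add, map_mul, map_mul, map_mul, div_add_div _ _ hB0 hB0']

theorem HasValue.mul {h h' : FractionRing X.CoordRing} {x : ℙ k (Fin (N + 1) → k)} {c c' : k}
    (H : X.HasValue h x c) (H' : X.HasValue h' x c') : X.HasValue (h * h') x (c * c') := by
  obtain ⟨d, A, B, hA, hB, hB0, rfl, rfl⟩ := H
  obtain ⟨e, A', B', hA', hB', hB0', rfl, rfl⟩ := H'
  refine ⟨d + e, A * A', B * B', hA.mul hA', hB.mul hB', ?_, ?_, ?_⟩
  · rw [map_mul]; exact mul_ne_zero hB0 hB0'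
  · rw [map_mul, map_mul, div_mul_div_comm]
  · rw [map_mul, map_mul, div_mul_div_comm]

theorem HasValue.unique {h : FractionRing X.CoordRing} {x : ℙ k (Fin (N + 1) → k)} {c c' : k}
    (hx : x ∈ X.points) (H : X.HasValue h x c) (H' : X.HasValue h x c') : c = c' := by
  obtain ⟨d, A, B, hA, hB, hB0, rfl, rfl⟩ := H
  obtain ⟨e, A', B', hA', hB', hB0', hh, rfl⟩ := H'
  rw [div_eq_div_iff (mt (X.toFrac_eq_zero_iff B).1 (notMem_of_eval_ne_zero hx hB0))
        (mt (X.toFrac_eq_zero_iff B').1 (notMem_of_eval_ne_zero hx hB0')),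
      ← map_mul, ← map_mul, ← sub_eq_zero, ← map_sub, toFrac_eq_zero_iff] at hh
  have := hx _ hh
  rw [map_sub, map_mul, map_mul, sub_eq_zero] at this
  rw [div_eq_div_iff hB0 hB0', this]

variable (X)

/-- The function field `K(γ_X(X))` of the closure of the image of the Gauss map, embedded into the
function field `K(X)` by pull-back of rational functions under `γ_X`. -/
noncomputable def gaussImageField : IntermediateField k X.functionField where
  carrier := {h | X.IsGaussPullback h}
  mul_mem' := by
    rintro h h' ⟨d, G, H, hG, hH, e, D, hD, hD0, P⟩ ⟨d', G', H', hG', hH', e', D', hD', hD0', P'⟩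
    refine ⟨d + d', G * G', H * H', hG.mul hG', hH.mul hH', e + e', D * D', hD.mul hD',
      fun h => (X.isPrime.mem_or_mem h).elim hD0 hD0', fun x hx => ?_⟩
    rw [map_mul, mul_ne_zero_iff] at hx
    obtain ⟨h1, h2⟩ := P x hx.1
    obtain ⟨h1', h2'⟩ := P' x hx.2
    rw [map_mul, map_mul, ← div_mul_div_comm]
    exact ⟨mul_ne_zero h1 h1', h2.mul h2'⟩
  add_mem' := by
    rintro h h' ⟨d, G, H, hG, hH, e, D, hD, hD0, P⟩ ⟨d', G', H', hG', hH', e', D', hD', hD0', P'⟩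
    refine ⟨d + d', G * H' + H * G', H * H', (hG.mul hH').add (hH.mul hG'), hH.mul hH', e + e',
      D * D', hD.mul hD', fun h => (X.isPrime.mem_or_mem h).elim hD0 hD0', fun x hx => ?_⟩
    rw [map_mul, mul_ne_zero_iff] at hx
    obtain ⟨h1, h2⟩ := P x hx.1
    obtain ⟨h1', h2'⟩ := P' x hx.2
    rw [map_add, map_mul, map_mul, map_mul, ← div_add_div _ _ h1 h1']
    exact ⟨mul_ne_zero h1 h1', h2.add x.2.1 h2'⟩
  algebraMap_mem' := fun c => by
    refine ⟨0, C c, 1, isHomogeneous_C _ _, isHomogeneous_one _ _, 0, 1, isHomogeneous_one _ _,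
      fun h => X.isPrime.ne_top ((Ideal.eq_top_iff_one _).2 h), fun x _ => ⟨by simp, ?_⟩⟩
    refine ⟨0, C c, 1, isHomogeneous_C _ _, isHomogeneous_one _ _, by simp, ?_, by simp⟩
    rw [map_one, div_one, ← MvPolynomial.algebraMap_eq, AlgHom.commutes]
    rfl
  inv_mem' := by
    rintro h ⟨d, G, H, hG, hH, e, D, hD, hD0, P⟩
    obtain ⟨a, A, B, hA, hB, hB0, hh⟩ := h.2
    by_cases hA0 : A ∈ X.ideal
    · have h0 : h = 0 := by
        apply Subtype.ext
        rw [hh, (X.toFrac_eq_zero_iff A).2 hA0, zero_div]; rfl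
      rw [h0, inv_zero, ← h0]
      exact ⟨d, G, H, hG, hH, e, D, hD, hD0, P⟩
    · refine ⟨d, H, G, hH, hG, (e + a) + a, (D * A) * B, (hD.mul hA).mul hB,
        fun h => (X.isPrime.mem_or_mem h).elim
          (fun h => (X.isPrime.mem_or_mem h).elim hD0 hA0) hB0, fun x hx => ?_⟩
      rw [map_mul, map_mul, mul_ne_zero_iff, mul_ne_zero_iff] at hx
      obtain ⟨h1, h2⟩ := P x hx.1.1
      have h3 := h2.unique x.2.1 ⟨a, A, B, hA, hB, hx.2, hh, rfl⟩
      have h4 : eval x.1.rep A / eval x.1.rep B ≠ 0 := div_ne_zero hx.1.2 hx.2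
      rw [← h3] at h4
      refine ⟨(div_ne_zero_iff.1 h4).1, a, B, A, hB, hA, hx.1.2, ?_, ?_⟩
      · rw [← inv_div (X.toFrac A), ← hh]; rfl
      · rw [← inv_div (eval _ G), h3, inv_div]

end ProjectiveVariety

/-!
Let `x` be `n` coordinates on `L / k` (that is, derivations of `L / k` that kill `x` vanish), let
`∂_i` be the dual derivations and let `φ ∈ L`. If `L = k(x, φ)`, the closure `X` of the point
`(1 : x : φ)` is a hypersurface with function field `L`, and its tangent space at the generic point
is spanned by the rows of a matrix whose entries, apart from an identity submatrix, are the
`∂_i φ` and `φ - ∑ i, x i * ∂_i φ`, the Legendre transform of `φ`. The function field of the Gauss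
image is generated by these entries. So it suffices to find `x` and `φ` with `k(x, φ) = L` such that
the Legendre transform generates `K`.

*The choice of `x` and `φ`* (`exists_legendre_coordinates_of_frame`). Let `r` be the rank of
`δ_{L/K}`, let `y_1, …, y_r ∈ K` have differentials that form a basis of the image of `δ_{L/K}`, let
`w_1, …, w_e` complete `y` to coordinates of `L / k`, and let `K = k(y, z_0, …, z_e)`. On `K` the
differentials of `L` satisfy `dz_j = ∑ i, a_ji dy_i`. Take `q` a quadratic form in `y` over `k`, and
put
`x_i = -(a_0i + ∑ j, w_j a_ji + ∂q/∂y_i)`, `φ = (z_0 + q) + ∑ i, x_i y_i + ∑ j, w_j z_j`.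
Then `dφ = ∑ i, y_i dx_i + ∑ j, z_j dw_j`, so with respect to the coordinates `(x, w)` the Legendre
transform of `φ` is `(z_0 + q, y, z_1, …, z_e)`, which generates `K`. That `(x, w)` are coordinates
means that the matrix of `x` with respect to `y` is invertible; this holds for a general multiple
of `q` if the symmetric matrix of second derivatives of `q` is invertible. Such a `q` exists if
`2 ≠ 0` or `r` is even (`exists_isUnit_det_add_transpose`), and this is where the parity
condition comes from.

*The field `k(x, w, φ)`*. Since `L` is separable algebraic over `k(x, w)`, the intermediate field
`E = k(x, w, φ)` is stable under the derivations dual to `(x, w)` (`Derivation.mem_of_isSeparable`),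
hence contains `K`. By the same argument for the coordinates `(y, w)` it contains the `a_ji`. So
`E = L` as soon as `L = K(a, w)`.

*The use of inseparability*. Since `L / K` is not separably generated, its transcendence degree is
less than `e` (`trdeg_lt_of_not_isSeparablyGenerated`), so `w` is algebraically dependent over
`K(a)`. One of its members `w_i` is then algebraic over the field generated by the others, over
which `L` becomes a finite extension that is separable over a simple subextension, hence simple
itself (`exists_adjoin_simple_eq_top_of_isSeparable_adjoin`). Replace `w_i` by a generator.

*Higher codimension*. For `N > n + 1` append powers of `s ^ p` to the point `(1 : x : φ)`, where
`s ∈ K` is transcendental over `k`. They lie in `K`, all derivations kill them, and they may be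
chosen linearly independent of the other coordinates. Since `1, x, φ` are linearly independent (if
`φ` were an affine linear function of `x`, its Legendre transform would be constant), this makes `X`
non-degenerate.

*The Gauss map*. The tangent matrix is computed at the generic point. A `TangentFrame` spreads it
out to an open subset of closed points, where it gives the Plücker coordinates, and the
Nullstellensatz compares rational functions with their values (`TangentFrame.gaussImageField_eq`).
-/

/-! ### Derivations, separability and differentials -/

section Derivations

open KaehlerDifferential Module

variable {k L : Type*} [Field k] [Field L] [Algebra k L]

/-- A derivation maps `k(s)` into an intermediate field `E` if `s` and its image lie in `E`. -/
theorem Derivation.mem_of_mem_adjoin (D : Derivation k L L) (E : IntermediateField k L) {s : Set L}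
    (hs : s ⊆ E) (hD : ∀ x ∈ s, D x ∈ E) {x : L} (hx : x ∈ IntermediateField.adjoin k s) :
    D x ∈ E := by
  have hle : IntermediateField.adjoin k s ≤ E := IntermediateField.adjoin_le_iff.2 hs
  induction hx using IntermediateField.adjoin_induction with
  | mem x hx => exact hD x hx
  | algebraMap x => rw [D.map_algebraMap]; exact E.zero_mem
  | add x y hx hy h1 h2 => rw [map_add]; exact E.add_mem h1 h2
  | inv x hx h =>
    rw [D.leibniz_inv, smul_eq_mul]
    exact E.mul_mem (E.neg_mem (pow_mem (E.inv_mem (hle hx)) 2)) h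
  | mul x y hx hy h1 h2 =>
    rw [D.leibniz, smul_eq_mul, smul_eq_mul]
    exact E.add_mem (E.mul_mem (hle hx) h2) (E.mul_mem (hle hy) h1)

theorem Derivation.eq_zero_of_mem_adjoin_of_tower {K : Type*} [Field K] [Algebra K L]
    (D : Derivation k L L) {s : Set L} (hK : ∀ c, D (algebraMap K L c) = 0)
    (hD : ∀ x ∈ s, D x = 0) {x : L} (hx : x ∈ IntermediateField.adjoin K s) : D x = 0 := by
  induction hx using IntermediateField.adjoin_induction with
  | mem x hx => exact hD x hx
  | algebraMap x => exact hK x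
  | add x y hx hy h1 h2 => rw [map_add, h1, h2, add_zero]
  | inv x hx h => rw [D.leibniz_inv, h, smul_zero]
  | mul x y hx hy h1 h2 => rw [D.leibniz, h1, h2, smul_zero, smul_zero, add_zero]

theorem Derivation.eq_zero_of_mem_adjoin (D : Derivation k L L) {s : Set L}
    (hD : ∀ x ∈ s, D x = 0) {x : L} (hx : x ∈ IntermediateField.adjoin k s) : D x = 0 :=
  D.eq_zero_of_mem_adjoin_of_tower D.map_algebraMap hD hx

/-- A derivation that kills an intermediate field `F` is `F`-linear. -/
def Derivation.extendScalarsOfEqZero (D : Derivation k L L) (F : IntermediateField k L)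
    (hD : ∀ x ∈ F, D x = 0) : Derivation F L L :=
  Derivation.mk'
    { toFun := D
      map_add' := map_add D
      map_smul' := fun c x => by
        have : c • x = (c : L) * x := rfl
        rw [this, D.leibniz, hD c c.2, smul_zero, add_zero]; rfl }
    fun a b => D.leibniz a b

/-- The derivation criterion for separability: `L / F` is separable algebraic if and only if
every derivation of `L / k` that kills `F` is zero. -/
theorem isSeparable_iff_forall_derivation [Algebra.EssFiniteType k L] (F : IntermediateField k L) :
    Algebra.IsSeparable F L ↔ ∀ D : Derivation k L L, (∀ x ∈ F, D x = 0) → D = 0 := by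
  have : Algebra.EssFiniteType F L := .of_comp k F L
  rw [← Algebra.FormallyUnramified.iff_isSeparable, Algebra.formallyUnramified_iff]
  constructor
  · intro h D hD
    ext x
    have h0 := (D.extendScalarsOfEqZero F hD).liftKaehlerDifferential_comp_D x
    rw [Subsingleton.elim (KaehlerDifferential.D F L x) 0, map_zero] at h0
    exact h0.symm
  · intro h
    by_contra hns
    rw [not_subsingleton_iff_nontrivial] at hns
    obtain ⟨φ, hφ, -⟩ := Submodule.exists_le_ker_of_lt_top (⊥ : Submodule L Ω[L⁄F]) bot_lt_top
    apply hφ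
    have h1 := h ((φ.compDer (KaehlerDifferential.D F L)).restrictScalars k) (fun x hx => by
      change φ.compDer (KaehlerDifferential.D F L) (algebraMap F L ⟨x, hx⟩) = 0
      exact Derivation.map_algebraMap _ _)
    apply Derivation.liftKaehlerDifferential_unique
    ext x
    simpa using DFunLike.congr_fun h1 x

theorem isSeparable_adjoin_iff_forall_derivation [Algebra.EssFiniteType k L] {ι : Type*}
    (x : ι → L) :
    Algebra.IsSeparable (IntermediateField.adjoin k (Set.range x)) L ↔
      ∀ D : Derivation k L L, (∀ i, D (x i) = 0) → D = 0 := by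
  rw [isSeparable_iff_forall_derivation]
  refine forall_congr' fun D => imp_congr_left ⟨fun h i => ?_, fun h y hy => ?_⟩
  · exact h _ (IntermediateField.subset_adjoin _ _ ⟨i, rfl⟩)
  · exact D.eq_zero_of_mem_adjoin (by rintro _ ⟨i, rfl⟩; exact h i) hy

/-- A family of elements of `L` separates derivations if and only if its differentials span. -/
theorem forall_derivation_iff_span_eq_top {ι : Type*} (x : ι → L) :
    (∀ D : Derivation k L L, (∀ i, D (x i) = 0) → D = 0) ↔
      Submodule.span L (Set.range fun i => D k L (x i)) = ⊤ := by
  constructor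
  · intro h
    by_contra hne
    obtain ⟨φ, hφ, hle⟩ := Submodule.exists_le_ker_of_lt_top _ (lt_top_iff_ne_top.2 hne)
    apply hφ
    apply Derivation.liftKaehlerDifferential_unique
    ext y
    have h1 := h (φ.compDer (KaehlerDifferential.D k L)) fun i =>
      hle (Submodule.subset_span ⟨i, rfl⟩)
    simpa using DFunLike.congr_fun h1 y
  · intro h E hE
    have h0 : E.liftKaehlerDifferential = 0 := by
      apply LinearMap.ext_on_range h
      intro i
      simp [hE]
    ext y
    have := E.liftKaehlerDifferential_comp_D y
    rw [h0] at this
    simpa using this.symm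

/-- The dimension of the space of differentials of a finitely generated extension of a perfect
field is its transcendence degree. -/
theorem finrank_kaehlerDifferential [PerfectField k] [Algebra.EssFiniteType k L] :
    (finrank L Ω[L⁄k] : Cardinal) = Algebra.trdeg k L := by
  apply le_antisymm
  · obtain ⟨s, hs, hsep⟩ := exists_isTranscendenceBasis_and_isSeparable_of_perfectField k L
    rw [← hs.cardinalMk_eq_trdeg, Cardinal.mk_fintype, Nat.cast_le]
    have h1 : Submodule.span L (Set.range fun i : s => D k L (i : L)) = ⊤ := by
      rw [← forall_derivation_iff_span_eq_top, ← isSeparable_adjoin_iff_forall_derivation,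
        Subtype.range_coe_subtype]
      exact hsep
    exact finrank_le_of_span_eq_top h1
  · obtain ⟨κ, a, ha, hsp, hli⟩ := exists_linearIndependent' L (D k L)
    rw [span_range_derivation] at hsp
    let b := Basis.mk hli hsp.ge
    have : Fintype κ := FiniteDimensional.fintypeBasisIndex b
    have h1 : Algebra.IsSeparable (IntermediateField.adjoin k (Set.range a)) L := by
      rw [isSeparable_adjoin_iff_forall_derivation, forall_derivation_iff_span_eq_top]
      exact hsp
    have h2 : Algebra.IsAlgebraic (Algebra.adjoin k (Set.range a)) L := by
      rw [← IntermediateField.isAlgebraic_adjoin_iff_top]; infer_instance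
    refine (Algebra.IsAlgebraic.trdeg_le_cardinalMk k (Set.range a)).trans ?_
    rw [finrank_eq_card_basis b, Cardinal.mk_range_eq a ha, Cardinal.mk_fintype]

/-- If `L` is separable algebraic over `k(x)` and the family `x` is as long as the dimension of
the space of differentials, there are derivations dual to `x`. -/
theorem exists_dual_derivations [Algebra.EssFiniteType k L] {ι : Type*} [Fintype ι] [DecidableEq ι]
    (x : ι → L) (hx : ∀ D : Derivation k L L, (∀ i, D (x i) = 0) → D = 0)
    (hcard : Fintype.card ι = finrank L Ω[L⁄k]) :
    ∃ δ : ι → Derivation k L L, ∀ i j, δ i (x j) = if i = j then 1 else 0 := by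
  have h1 := (forall_derivation_iff_span_eq_top x).1 hx
  have hli := linearIndependent_of_top_le_span_of_card_eq_finrank h1.ge hcard
  let b := Basis.mk hli h1.ge
  have hb : ∀ j, D k L (x j) = b j := fun j => by simp [b]
  refine ⟨fun i => (b.coord i).compDer (D k L), fun i j => ?_⟩
  change b.coord i (D k L (x j)) = _
  rw [hb, Basis.coord_apply, b.repr_self, Finsupp.single_apply]
  simp only [eq_comm]

theorem Derivation.sum_smul_apply {ι : Type*} [Fintype ι] (c : ι → L) (δ : ι → Derivation k L L)
    (z : L) : (∑ i, c i • δ i) z = ∑ i, c i * δ i z := by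
  have : (∑ i, c i • δ i : Derivation k L L) z = Derivation.coeFnAddMonoidHom (∑ i, c i • δ i) z :=
    rfl
  rw [this, map_sum, Finset.sum_apply]
  rfl

theorem Derivation.eq_sum_smul_dual {ι : Type*} [Fintype ι] [DecidableEq ι]
    {x : ι → L} (hx : ∀ D : Derivation k L L, (∀ i, D (x i) = 0) → D = 0)
    {δ : ι → Derivation k L L} (hδ : ∀ i j, δ i (x j) = if i = j then 1 else 0)
    (D : Derivation k L L) : D = ∑ i, D (x i) • δ i := by
  rw [← sub_eq_zero]
  apply hx
  intro j
  rw [Derivation.sub_apply, Derivation.sum_smul_apply]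
  simp [hδ]

theorem Derivation.apply_eq_sum_dual {ι : Type*} [Fintype ι] [DecidableEq ι]
    {x : ι → L} (hx : ∀ D : Derivation k L L, (∀ i, D (x i) = 0) → D = 0)
    {δ : ι → Derivation k L L} (hδ : ∀ i j, δ i (x j) = if i = j then 1 else 0)
    (D : Derivation k L L) (z : L) : D z = ∑ i, D (x i) * δ i z := by
  conv_lhs => rw [D.eq_sum_smul_dual hx hδ]
  exact Derivation.sum_smul_apply _ _ _

/-- Dual derivations commute. -/
theorem Derivation.dual_comm {ι : Type*} [DecidableEq ι]
    {x : ι → L} (hx : ∀ D : Derivation k L L, (∀ i, D (x i) = 0) → D = 0)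
    {δ : ι → Derivation k L L} (hδ : ∀ i j, δ i (x j) = if i = j then 1 else 0)
    (i j : ι) (z : L) : δ i (δ j z) = δ j (δ i z) := by
  have h : ⁅δ i, δ j⁆ = 0 := by
    apply hx
    intro l
    rw [Derivation.commutator_apply, hδ, hδ]
    split_ifs <;> simp
  rw [← sub_eq_zero, ← Derivation.commutator_apply, h, Derivation.zero_apply]

/-- A derivation of `L` that maps `F` into an intermediate field `E` of a separable algebraic
extension `L / F` maps `E` into itself. -/
theorem Derivation.mem_of_isSeparable (D : Derivation k L L) {F E : IntermediateField k L}
    (hFE : F ≤ E) [Algebra.IsSeparable F L] (hD : ∀ x ∈ F, D x ∈ E) {x : L} (hx : x ∈ E) :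
    D x ∈ E := by
  -- differentiate the equation `f(x) = 0`
  let f := minpoly F x
  have hsep : Polynomial.aeval x (Polynomial.derivative f) ≠ 0 :=
    (Algebra.IsSeparable.isSeparable F x).aeval_derivative_ne_zero (minpoly.aeval F x)
  have hmem : ∀ g : Polynomial F, Polynomial.aeval x g ∈ E := fun g => by
    rw [Polynomial.aeval_eq_sum_range]
    exact sum_mem fun i _ => E.mul_mem (hFE (g.coeff i).2) (pow_mem hx i)
  -- the coefficientwise derivative of a polynomial over `F`, evaluated at `x`, lies in `E`
  have key : ∀ g : Polynomial F, D (Polynomial.aeval x g) -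
      Polynomial.aeval x (Polynomial.derivative g) * D x ∈ E := fun g => by
    induction g using Polynomial.induction_on' with
    | add p q hp hq =>
      have := E.add_mem hp hq
      rw [map_add, map_add, map_add, map_add]
      convert this using 1
      ring
    | monomial n a =>
      have : D (Polynomial.aeval x (Polynomial.monomial n a)) -
          Polynomial.aeval x (Polynomial.derivative (Polynomial.monomial n a)) * D x
          = x ^ n * D (a : L) := by
        rw [Polynomial.derivative_monomial, Polynomial.aeval_monomial, Polynomial.aeval_monomial,
          D.leibniz, D.leibniz_pow, map_mul (algebraMap F L), _root_.map_natCast (algebraMap F L)]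
        change (a : L) • (n • x ^ (n - 1) • D x) + x ^ n • D (a : L) -
          (a : L) * (n : L) * x ^ (n - 1) * D x = _
        simp only [smul_eq_mul, nsmul_eq_mul]
        ring
      rw [this]
      exact E.mul_mem (pow_mem hx n) (hD _ a.2)
  have h1 := key f
  rw [minpoly.aeval, map_zero, zero_sub] at h1
  have h2 := E.div_mem (E.neg_mem h1) (hmem (Polynomial.derivative f))
  rwa [neg_neg, mul_div_cancel_left₀ _ hsep] at h2

end Derivations

/-! ### Generators of field extensions -/

section Fields

open KaehlerDifferential Module IntermediateField

/-- A linearly independent family extends to a basis by members of a spanning family `f`. -/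
theorem exists_linearIndependent_sumElim {R M ι X : Type*} [Field R] [AddCommGroup M] [Module R M]
    [Module.Finite R M] [Fintype ι] {v : ι → M} (hv : LinearIndependent R v) (f : X → M)
    (hf : Submodule.span R (Set.range f) = ⊤) :
    ∃ (e : ℕ) (w : Fin e → X), LinearIndependent R (Sum.elim v (f ∘ w)) ∧
      Fintype.card ι + e = finrank R M := by
  let V := Submodule.span R (Set.range v)
  obtain ⟨κ, a, ha, hsp, hli⟩ := exists_linearIndependent' R (V.mkQ ∘ f)
  have hfin : Finite κ := hli.finite
  have : Fintype κ := Fintype.ofFinite κ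
  have htop : Submodule.span R (Set.range ((V.mkQ ∘ f) ∘ a)) = ⊤ := by
    rw [hsp, Set.range_comp, Submodule.span_image, hf, Submodule.map_top, V.range_mkQ]
  have hV : finrank R V = Fintype.card ι := finrank_span_eq_card hv
  have hκ : finrank R (M ⧸ V) = Fintype.card κ :=
    finrank_eq_card_basis (Basis.mk hli htop.ge)
  let ε := (Fintype.equivFin κ).symm
  refine ⟨Fintype.card κ, a ∘ ε, ?_, ?_⟩
  · have h1 : LinearIndependent R (fun i => (⟨v i, Submodule.subset_span ⟨i, rfl⟩⟩ : V)) :=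
      LinearIndependent.of_comp V.subtype hv
    exact h1.sumElim_of_quotient (f ∘ a ∘ ε) (hli.comp ε ε.injective)
  · rw [← hV, ← hκ, add_comm, Submodule.finrank_quotient_add_finrank]

/-- A finite extension `E / F` of infinite fields is simple if it is separable over a simple
subextension `F(α)`. -/
theorem exists_adjoin_simple_eq_top_of_isSeparable_adjoin {F E : Type*} [Field F] [Field E]
    [Algebra F E] [Infinite F] (q : ℕ) [ExpChar F q] [FiniteDimensional F E] (α : E)
    [Algebra.IsSeparable F⟮α⟯ E] : ∃ γ : E, F⟮γ⟯ = ⊤ := by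
  have : ExpChar E q := expChar_of_injective_algebraMap (algebraMap F E).injective q
  have : ExpChar F⟮α⟯ q :=
    expChar_of_injective_algebraMap (algebraMap F F⟮α⟯).injective q
  obtain ⟨θ, hθ⟩ := Field.exists_primitive_element F⟮α⟯ E
  let S := separableClosure F E
  -- powers `b`, `a` of `θ`, `α` lie in the separable closure `S` of `F`; then `E = F(α, b)`
  obtain ⟨n, ⟨b, hb⟩⟩ := IsPurelyInseparable.pow_mem S q θ
  obtain ⟨m, ⟨a, ha⟩⟩ := IsPurelyInseparable.pow_mem S q α
  have hb' : (b : E) = θ ^ q ^ n := hb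
  have ha' : (a : E) = α ^ q ^ m := ha
  have htop : F⟮α, (b : E)⟯ = ⊤ := by
    rw [← adjoin_simple_adjoin_simple, hb',
      ← adjoin_simple_eq_adjoin_pow_expChar_pow_of_isSeparable' F⟮α⟯ E θ q n, hθ,
      restrictScalars_top]
  -- as in the primitive element theorem, two of the fields `F(a + c ^ q ^ m b ^ q ^ m)` coincide
  have : Finite (IntermediateField F S) :=
    Field.finite_intermediateField_of_exists_primitive_element F S
      (Field.exists_primitive_element F S)
  obtain ⟨x, y, hxy, heq⟩ := Finite.exists_ne_map_eq_of_infinite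
    fun c : F => F⟮a + c ^ q ^ m • b ^ q ^ m⟯
  have hc : x ^ q ^ m - y ^ q ^ m ≠ 0 := by
    rw [← sub_pow_expChar_pow]
    exact pow_ne_zero _ (sub_ne_zero.2 hxy)
  -- `b ^ q ^ m` lies in the common subfield of `S`
  have h1 : b ^ q ^ m ∈ F⟮a + x ^ q ^ m • b ^ q ^ m⟯ := by
    have h2 := mem_adjoin_simple_self F (a + y ^ q ^ m • b ^ q ^ m)
    rw [← show F⟮a + x ^ q ^ m • b ^ q ^ m⟯ = F⟮a + y ^ q ^ m • b ^ q ^ m⟯ from heq] at h2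
    have h3 := sub_mem (mem_adjoin_simple_self F (a + x ^ q ^ m • b ^ q ^ m)) h2
    have h4 : a + x ^ q ^ m • b ^ q ^ m - (a + y ^ q ^ m • b ^ q ^ m) =
        (x ^ q ^ m - y ^ q ^ m) • b ^ q ^ m := by rw [sub_smul]; abel
    rw [h4] at h3
    have h5 := IntermediateField.smul_mem _ h3 (x := (x ^ q ^ m - y ^ q ^ m)⁻¹)
    rwa [smul_smul, inv_mul_cancel₀ hc, one_smul] at h5
  let γ : E := α + x • (b : E)
  have h6 : (b : E) ^ q ^ m ∈ F⟮γ⟯ := by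
    have h7 : S.val (b ^ q ^ m) ∈ (F⟮a + x ^ q ^ m • b ^ q ^ m⟯).map S.val :=
      ⟨_, h1, rfl⟩
    rw [adjoin_map, Set.image_singleton] at h7
    have h8 : S.val (a + x ^ q ^ m • b ^ q ^ m) = γ ^ q ^ m := by
      have : S.val (a + x ^ q ^ m • b ^ q ^ m) = (a : E) + x ^ q ^ m • (b : E) ^ q ^ m := rfl
      rw [this, ha', add_pow_expChar_pow, smul_pow]
    rw [h8] at h7
    exact (adjoin_simple_le_iff.2 (pow_mem (mem_adjoin_simple_self F γ) _)) h7
  have h9 : (b : E) ∈ F⟮γ⟯ := by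
    have hs : IsSeparable F (b : E) := mem_separableClosure_iff.1 b.2
    have h10 := mem_adjoin_simple_self F (b : E)
    rw [adjoin_simple_eq_adjoin_pow_expChar_pow_of_isSeparable F E hs q m] at h10
    exact (adjoin_simple_le_iff.2 h6) h10
  refine ⟨γ, top_le_iff.1 ?_⟩
  rw [← htop, adjoin_le_iff]
  have h11 : α ∈ F⟮γ⟯ := by
    have h12 := sub_mem (mem_adjoin_simple_self F γ) (IntermediateField.smul_mem _ h9 (x := x))
    rwa [show γ - x • (b : E) = α by simp [γ]] at h12
  rintro z (rfl | rfl)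
  exacts [h11, h9]

end Fields

/-! ### Coordinates adapted to a subfield -/

section Frame

open KaehlerDifferential Module IntermediateField

/-- A member of an algebraically dependent family is algebraic over the field generated by the
others. -/
theorem exists_mem_isAlgebraic_adjoin_compl {F L ι : Type*} [Field F] [Field L] [Algebra F L]
    {w : ι → L} (hw : ¬ AlgebraicIndependent F w) :
    ∃ i, IsAlgebraic (adjoin F (w '' {i}ᶜ)) (w i) := by
  by_contra! h
  apply hw
  refine algebraicIndependent_of_finite_type' (algebraMap F L).injective fun t _ _ i hi halg => ?_
  apply h i
  rw [← isAlgebraic_adjoin_iff] at halg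
  have hle : adjoin F (w '' t) ≤ adjoin F (w '' {i}ᶜ) :=
    adjoin.mono _ _ _ (Set.image_mono fun j hj hji => hi (hji ▸ hj))
  obtain ⟨g, hg, hg0⟩ := halg
  refine ⟨g.map (inclusion hle).toRingHom, ?_, ?_⟩
  · exact (Polynomial.map_ne_zero_iff (inclusion hle).toRingHom.injective).2 hg
  · rw [Polynomial.aeval_def, Polynomial.eval₂_map]
    exact hg0

/-- A finitely generated extension `L / F` of infinite fields which is separable algebraic over
`F(w)`, where the finite family `w` is algebraically dependent over `F`, is generated by a
family that differs from `w` in one member only. -/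
theorem exists_adjoin_update_eq_top {F L ι : Type*} [Field F] [Field L] [Algebra F L] [Infinite F]
    [Algebra.EssFiniteType F L] [DecidableEq ι] (q : ℕ) [ExpChar F q] {w : ι → L}
    (hw : ¬ AlgebraicIndependent F w) (hsep : Algebra.IsSeparable (adjoin F (Set.range w)) L) :
    ∃ (i : ι) (γ : L), adjoin F (Set.range (Function.update w i γ)) = ⊤ := by
  obtain ⟨i, hi⟩ := exists_mem_isAlgebraic_adjoin_compl hw
  let F' := adjoin F (w '' {i}ᶜ)
  have hext : (F'⟮w i⟯).restrictScalars F = adjoin F (Set.range w) := by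
    rw [adjoin_adjoin_left]
    congr 1
    rw [← Set.image_singleton, ← Set.image_union, Set.compl_union_self, Set.image_univ]
  have hsep' : Algebra.IsSeparable F'⟮w i⟯ L := by
    have : Algebra.IsSeparable ((F'⟮w i⟯).restrictScalars F) L := by rw [hext]; exact hsep
    exact this
  have : Infinite F' := Infinite.of_injective _ (algebraMap F F').injective
  have : ExpChar F' q := expChar_of_injective_algebraMap (algebraMap F F').injective q
  have : Algebra.EssFiniteType F' L := .of_comp F F' L
  have h1 : Algebra.IsAlgebraic F' F'⟮w i⟯ :=
    isAlgebraic_adjoin_simple (isAlgebraic_iff_isIntegral.1 hi)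
  have : Algebra.IsAlgebraic F' L := Algebra.IsAlgebraic.trans F' F'⟮w i⟯ L
  have : FiniteDimensional F' L := Algebra.finite_of_essFiniteType_of_isAlgebraic
  obtain ⟨γ, hγ⟩ := exists_adjoin_simple_eq_top_of_isSeparable_adjoin q (w i) (F := F')
  refine ⟨i, γ, ?_⟩
  have h2 : (F'⟮γ⟯).restrictScalars F = ⊤ := by rw [hγ, restrictScalars_top]
  rw [← h2, adjoin_adjoin_left]
  congr 1
  ext z
  constructor
  · rintro ⟨j, rfl⟩
    by_cases hj : j = i
    · subst hj; simp
    · left; exact ⟨j, hj, by simp [hj]⟩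
  · rintro (⟨j, hj, rfl⟩ | rfl)
    · exact ⟨j, by simp [Set.mem_compl_singleton_iff.1 hj]⟩
    · exact ⟨i, by simp⟩

variable (k K L : Type*) [Field k] [Field K] [Field L] [Algebra k K] [Algebra K L] [Algebra k L]
  [IsScalarTower k K L]

theorem range_mapBaseChange_eq_span :
    LinearMap.range (mapBaseChange k K L) =
      Submodule.span L (Set.range fun y : K => D k L (algebraMap K L y)) := by
  have h : Submodule.span L (Set.range fun y : K => (1 : L) ⊗ₜ[K] D k K y) = ⊤ := by
    have h1 := Submodule.baseChange_span (R := K) (A := L) (Set.range (D k K))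
    rw [span_range_derivation, Submodule.baseChange_top] at h1
    rw [h1, ← Set.range_comp]
    rfl
  rw [LinearMap.range_eq_map, ← h, Submodule.map_span, ← Set.range_comp]
  congr 2
  ext y
  simp

/-- Elements `y` of `K` whose differentials are a basis of the image of `δ_{L/K}`, and elements `w`
of `L` which complete them to a system of coordinates of `L / k`. -/
theorem exists_adapted_coordinates [Algebra.EssFiniteType k L] :
    ∃ (e : ℕ) (y : Fin (deltaRank k K L) → K) (w : Fin e → L),
      (∀ D : Derivation k L L, (∀ i, D (algebraMap K L (y i)) = 0) →
        ∀ z, D (algebraMap K L z) = 0) ∧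
      LinearIndependent L (Sum.elim (fun i => D k L (algebraMap K L (y i))) (D k L ∘ w)) ∧
      deltaRank k K L + e = finrank L Ω[L⁄k] := by
  obtain ⟨κ, a, ha, hsp, hli⟩ :=
    exists_linearIndependent' L fun y : K => D k L (algebraMap K L y)
  have hfin : Finite κ := hli.finite
  have : Fintype κ := Fintype.ofFinite κ
  have hr : deltaRank k K L = Fintype.card κ := by
    rw [deltaRank, range_mapBaseChange_eq_span, ← hsp, finrank_span_eq_card hli]
  obtain ⟨ε⟩ : Nonempty (Fin (deltaRank k K L) ≃ κ) := ⟨(Fintype.equivFinOfCardEq hr.symm).symm⟩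
  have hli' : LinearIndependent L fun i => D k L (algebraMap K L (a (ε i))) :=
    hli.comp ε ε.injective
  obtain ⟨e, w, hw, hcard⟩ := exists_linearIndependent_sumElim hli' (D k L)
    (span_range_derivation k L)
  refine ⟨e, a ∘ ε, w, fun E hE z => ?_, hw, by rwa [Fintype.card_fin] at hcard⟩
  have h1 : D k L (algebraMap K L z) ∈ LinearMap.ker E.liftKaehlerDifferential := by
    have h2 : D k L (algebraMap K L z) ∈
        Submodule.span L (Set.range fun y : K => D k L (algebraMap K L y)) :=
      Submodule.subset_span ⟨z, rfl⟩
    rw [← hsp] at h2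
    refine Submodule.span_le.2 ?_ h2
    rintro _ ⟨j, rfl⟩
    have := hE (ε.symm j)
    simp only [Function.comp_apply, Equiv.apply_symm_apply] at this
    simpa using this
  simpa using h1

variable {k K L}

/-- If `L / K` is not separably generated, the image of `δ_{L/K}` has more than `trdeg L / K`
complementary dimensions. -/
theorem trdeg_lt_of_not_isSeparablyGenerated [Algebra.EssFiniteType k L] {e r : ℕ}
    {y : Fin r → K} {w : Fin e → L}
    (hyw : ∀ D : Derivation k L L, (∀ i, D (algebraMap K L (y i)) = 0) → (∀ j, D (w j) = 0) → D = 0)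
    (hinsep : ¬ IsSeparablyGenerated K L) : Algebra.trdeg K L < e := by
  by_contra! hle
  apply hinsep
  have hsep : Algebra.IsSeparable (adjoin K (Set.range w)) L := by
    have : Algebra.IsSeparable ((adjoin K (Set.range w)).restrictScalars k) L := by
      rw [isSeparable_iff_forall_derivation]
      intro D hD
      refine hyw D (fun i => hD _ ?_) fun j => hD _ ?_
      · exact (adjoin K (Set.range w)).algebraMap_mem (y i)
      · exact subset_adjoin K _ ⟨j, rfl⟩
    exact this
  have halg : Algebra.IsAlgebraic (Algebra.adjoin K (Set.range w)) L := by
    rw [← isAlgebraic_adjoin_iff_top]; infer_instance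
  have htb : IsTranscendenceBasis K w := by
    apply Algebra.IsAlgebraic.isTranscendenceBasis_of_lift_le_trdeg_of_finite
    simpa using hle
  exact ⟨Set.range w, htb.to_subtype_range, hsep⟩

/-- Finitely many elements of `K` with linearly independent differentials extend to a set of
`trdeg K + 1` generators. -/
theorem exists_adjoin_range_union_range_eq_top [PerfectField k] [Algebra.EssFiniteType k K]
    {r e : ℕ} {y : Fin r → K} (hy : LinearIndependent K fun i => D k K (y i))
    (he : Algebra.trdeg k K ≤ (r + e : ℕ)) :
    ∃ z : Fin (e + 1) → K, adjoin k (Set.range y ∪ Set.range z) = ⊤ := by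
  obtain ⟨e', z', hz', hcard⟩ := exists_linearIndependent_sumElim hy (D k K)
    (span_range_derivation k K)
  have hle : e' ≤ e := by
    rw [← finrank_kaehlerDifferential, ← hcard, Fintype.card_fin, Nat.cast_le] at he
    omega
  let F := adjoin k (Set.range (Sum.elim y z'))
  have hsep : Algebra.IsSeparable F K := by
    rw [isSeparable_adjoin_iff_forall_derivation, forall_derivation_iff_span_eq_top]
    have h1 : (fun i => D k K (Sum.elim y z' i)) =
        Sum.elim (fun i => D k K (y i)) (D k K ∘ z') := by
      ext (i | i) <;> rfl
    rw [h1]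
    apply hz'.span_eq_top_of_card_eq_finrank'
    rw [← hcard]; simp
  have : Algebra.EssFiniteType F K := .of_comp k F K
  have : FiniteDimensional F K := Algebra.finite_of_essFiniteType_of_isAlgebraic
  obtain ⟨θ, hθ⟩ := Field.exists_primitive_element F K
  refine ⟨Fin.cons θ fun j => if h : (j : ℕ) < e' then z' ⟨j, h⟩ else 0, top_le_iff.1 ?_⟩
  have h2 : (F⟮θ⟯).restrictScalars k = ⊤ := by rw [hθ, restrictScalars_top]
  rw [← h2, adjoin_adjoin_left]
  apply adjoin.mono
  rintro x (⟨i | i, rfl⟩ | rfl)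
  · left; exact ⟨i, rfl⟩
  · right
    refine ⟨Fin.succ ⟨i, i.2.trans_le hle⟩, ?_⟩
    rw [Fin.cons_succ]
    simp
  · right; exact ⟨0, rfl⟩

end Frame

/-! ### Legendre transforms that generate a subfield -/

section Legendre

open KaehlerDifferential Module IntermediateField

/-- The symmetrization of a bilinear form can be nondegenerate: always if `2 ≠ 0`, and in even
dimension in general. -/
theorem exists_isUnit_det_add_transpose (k : Type*) [Field k] (r : ℕ)
    (h : (2 : k) ≠ 0 ∨ Even r) :
    ∃ A : Matrix (Fin r) (Fin r) k, IsUnit (A + A.transpose).det := by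
  rcases h with h | ⟨s, rfl⟩
  · refine ⟨1, ?_⟩
    rw [Matrix.transpose_one, one_add_one_eq_two, isUnit_iff_ne_zero]
    have : (2 : Matrix (Fin r) (Fin r) k) = (2 : k) • 1 := by
      rw [two_smul, one_add_one_eq_two]
    rw [this, Matrix.det_smul, Matrix.det_one, mul_one]
    exact pow_ne_zero _ h
  · -- the symmetrization of `B` is the hyperbolic form
    let B : Matrix (Fin s ⊕ Fin s) (Fin s ⊕ Fin s) k := Matrix.fromBlocks 0 1 0 0
    refine ⟨Matrix.reindex finSumFinEquiv finSumFinEquiv B, ?_⟩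
    rw [Matrix.transpose_reindex, ← Matrix.coe_reindexLinearEquiv k k, ← map_add,
      Matrix.coe_reindexLinearEquiv, Matrix.det_reindex_self]
    apply Matrix.isUnit_det_of_left_inverse (B := B + B.transpose)
    simp [B, Matrix.fromBlocks_transpose, Matrix.fromBlocks_add, Matrix.fromBlocks_multiply,
      Matrix.fromBlocks_one]

/-- The determinant of `c M + S` is a nonzero polynomial in `c`: up to the unit `det M`, it is the
characteristic polynomial of `-M⁻¹ S`. -/
theorem exists_det_smul_add_ne_zero {k L ι : Type*} [Field k] [Field L] [Algebra k L] [Infinite k]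
    [Fintype ι] [DecidableEq ι] (M S : Matrix ι ι L) (hM : IsUnit M.det) :
    ∃ c : k, (algebraMap k L c • M + S).det ≠ 0 := by
  classical
  let P := (-(M⁻¹ * S)).charpoly
  have hP : P ≠ 0 := (Matrix.charpoly_monic _).ne_zero
  obtain ⟨c, hc⟩ := Infinite.exists_notMem_finset
    (P.roots.toFinset.preimage (algebraMap k L) (algebraMap k L).injective.injOn)
  refine ⟨c, fun h => hc ?_⟩
  rw [Finset.mem_preimage, Multiset.mem_toFinset, Polynomial.mem_roots hP, Polynomial.IsRoot,
    Matrix.eval_charpoly, sub_neg_eq_add]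
  have h1 : algebraMap k L c • M + S = M * (Matrix.scalar ι (algebraMap k L c) + M⁻¹ * S) := by
    rw [mul_add, Matrix.mul_nonsing_inv_cancel_left _ _ hM]
    congr 1
    ext i j
    simp [Matrix.scalar_apply, mul_comm]
  rw [h1, Matrix.det_mul] at h
  exact (mul_eq_zero.1 h).resolve_left hM.ne_zero

/-- The derivative of the quadratic form of `A` involves the symmetrization of `A` only. -/
theorem Derivation.apply_quadratic {k L : Type*} [Field k] [Field L] [Algebra k L] {r : ℕ}
    (A : Matrix (Fin r) (Fin r) k) (y : Fin r → L) (D : Derivation k L L) :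
    D (∑ i, ∑ l, algebraMap k L (A i l) * (y i * y l)) =
      ∑ i, (∑ l, algebraMap k L ((A + A.transpose) i l) * y l) * D (y i) := by
  have h1 : ∀ i l, D (algebraMap k L (A i l) * (y i * y l)) =
      algebraMap k L (A i l) * y i * D (y l) + algebraMap k L (A i l) * y l * D (y i) := by
    intro i l
    rw [D.leibniz, D.leibniz, D.map_algebraMap]
    simp only [smul_eq_mul]
    ring
  simp only [map_sum, h1, Finset.sum_add_distrib, Matrix.add_apply, Matrix.transpose_apply, map_add,
    add_mul, Finset.sum_mul]
  rw [add_comm]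
  congr 1
  exact Finset.sum_comm

variable {k K L : Type*} [Field k] [Field K] [Field L] [Algebra k K] [Algebra K L] [Algebra k L]
  [IsScalarTower k K L]

/-- The main construction. Let `(y, w)` be coordinates of `L / k` such that `K = k(y, z)` and such
that `L` is generated over `K` by `w` and the derivatives of `z` with respect to `y`. Then there are
coordinates `x` of `L / k` and `φ ∈ L` with `k(x, φ) = L` such that the Legendre transform of `φ`
generates `K`. -/
theorem exists_legendre_coordinates_of_frame [Infinite k] [Algebra.EssFiniteType k L] {r e : ℕ}
    {y : Fin r → K} {z : Fin (e + 1) → K} {w : Fin e → L}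
    (hcard : r + e = finrank L Ω[L⁄k])
    (hyw : ∀ D : Derivation k L L, (∀ i, D (Sum.elim (fun i => algebraMap K L (y i)) w i) = 0) →
      D = 0)
    (hy : ∀ D : Derivation k L L, (∀ i, D (algebraMap K L (y i)) = 0) →
        ∀ z, D (algebraMap K L z) = 0)
    (hK : adjoin k (Set.range y ∪ Set.range z) = ⊤)
    {δ : Fin r ⊕ Fin e → Derivation k L L}
    (hδ : ∀ i j, δ i (Sum.elim (fun i => algebraMap K L (y i)) w j) = if i = j then 1 else 0)
    (hw : adjoin K ((Set.range fun ji : Fin (e + 1) × Fin r =>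
      δ (Sum.inl ji.2) (algebraMap K L (z ji.1))) ∪ Set.range w) = ⊤)
    {A : Matrix (Fin r) (Fin r) k} (hA : IsUnit (A + A.transpose).det) :
    ∃ (x : Fin r ⊕ Fin e → L) (φ : L) (δ' : Fin r ⊕ Fin e → Derivation k L L),
      (∀ D : Derivation k L L, (∀ i, D (x i) = 0) → D = 0) ∧
      (∀ i j, δ' i (x j) = if i = j then 1 else 0) ∧
      adjoin k (insert φ (Set.range x)) = ⊤ ∧
      adjoin k (insert (φ - ∑ i, x i * δ' i φ) (Set.range fun i => δ' i φ)) =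
        (IsScalarTower.toAlgHom k K L).fieldRange := by
  let Y : Fin r → L := fun i => algebraMap K L (y i)
  let Z : Fin (e + 1) → L := fun j => algebraMap K L (z j)
  let a : Fin (e + 1) → Fin r → L := fun j i => δ (Sum.inl i) (Z j)
  have hδK : ∀ m z, δ (Sum.inr m) (algebraMap K L z) = 0 := fun m =>
    hy _ fun i => (hδ (Sum.inr m) (Sum.inl i)).trans (by simp)
  have hDZ : ∀ (D : Derivation k L L) j, D (Z j) = ∑ i, a j i * D (Y i) := by
    intro D j
    rw [D.apply_eq_sum_dual hyw hδ, Fintype.sum_sum_type]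
    simp only [Sum.elim_inl, Z, hδK, mul_zero, Finset.sum_const_zero, add_zero]
    exact Finset.sum_congr rfl fun i _ => mul_comm _ _
  have hDa : ∀ (D : Derivation k L L) j i,
      D (a j i) = ∑ l, δ (Sum.inl l) (a j i) * D (Y l) := by
    intro D j i
    have h0 : ∀ m, δ (Sum.inr m) (a j i) = 0 := fun m => by
      rw [Derivation.dual_comm hyw hδ, hδK, map_zero]
    rw [D.apply_eq_sum_dual hyw hδ, Fintype.sum_sum_type]
    simp only [Sum.elim_inl, h0, mul_zero, Finset.sum_const_zero, add_zero]
    exact Finset.sum_congr rfl fun i _ => mul_comm _ _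
  let M : Matrix (Fin r) (Fin r) L := (A + A.transpose).map (algebraMap k L)
  have hM : IsUnit M.det := by
    have h := hA.map (algebraMap k L)
    rwa [RingHom.map_det] at h
  let S : Matrix (Fin r) (Fin r) L := Matrix.of fun i l =>
    δ (Sum.inl l) (a 0 i) + ∑ j, w j * δ (Sum.inl l) (a (Fin.succ j) i)
  obtain ⟨c, hc⟩ := exists_det_smul_add_ne_zero (k := k) M S hM
  let Q : L := ∑ i, ∑ l, algebraMap k L (A i l) * (Y i * Y l)
  have hDQ : ∀ D : Derivation k L L, D Q = ∑ i, (∑ l, M i l * Y l) * D (Y i) := fun D =>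
    D.apply_quadratic A Y
  let x : Fin r → L := fun i =>
    -(a 0 i + ∑ j, w j * a (Fin.succ j) i + algebraMap k L c * ∑ l, M i l * Y l)
  let y0 : L := Z 0 + algebraMap k L c * Q
  let φ : L := y0 + ∑ i, x i * Y i + ∑ j, w j * Z (Fin.succ j)
  have hDM : ∀ (D : Derivation k L L) i l, D (M i l) = 0 := fun D i l => D.map_algebraMap _
  have hDc : ∀ (D : Derivation k L L) b, D (algebraMap k L c * b) = algebraMap k L c * D b :=
    fun D b => by rw [D.leibniz, D.map_algebraMap, smul_zero, add_zero, smul_eq_mul]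
  have hDmul : ∀ (D : Derivation k L L) b b', D (b * b') = b * D b' + b' * D b := fun D b b' =>
    D.leibniz b b'
  -- the coordinates `x, w` separate derivations because the matrix `c M + S` is invertible
  have hxw : ∀ D : Derivation k L L, (∀ i, D (Sum.elim x w i) = 0) → D = 0 := by
    intro D hD
    have hDw : ∀ j, D (w j) = 0 := fun j => hD (Sum.inr j)
    have hDx : ∀ i, D (x i) = 0 := fun i => hD (Sum.inl i)
    have h1 : (algebraMap k L c • M + S).mulVec (fun l => D (Y l)) = 0 := by
      ext i
      have h2 := hDx i
      simp only [x, map_neg, map_add, map_sum, hDc, hDmul, hDM, hDw, mul_zero, add_zero,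
        hDa D] at h2
      rw [neg_eq_zero] at h2
      rw [Pi.zero_apply, ← h2]
      simp only [Matrix.mulVec, dotProduct, Matrix.add_apply, Matrix.smul_apply, S, Matrix.of_apply,
        smul_eq_mul, add_mul, Finset.sum_add_distrib, Finset.sum_mul, Finset.mul_sum, mul_assoc]
      rw [Finset.sum_comm (γ := Fin e)]
      ring
    have h3 := Matrix.eq_zero_of_mulVec_eq_zero hc h1
    refine hyw D ?_
    rintro (i | j)
    exacts [congrFun h3 i, hDw j]
  -- the choice of `x` means that `dy0 + ∑ i, x i dY i + ∑ j, w j dZ (j + 1) = 0`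
  have hDφ : ∀ D : Derivation k L L,
      D φ = ∑ i, Y i * D (x i) + ∑ j, Z (Fin.succ j) * D (w j) := by
    intro D
    have h1 : D (Z 0) + algebraMap k L c * D Q + ∑ i, x i * D (Y i) +
        ∑ j, w j * D (Z (Fin.succ j)) = 0 := by
      have h2 : ∀ i, x i * D (Y i) = -(a 0 i * D (Y i) + (∑ j, w j * a (Fin.succ j) i) * D (Y i) +
          algebraMap k L c * ((∑ l, M i l * Y l) * D (Y i))) := fun i => by
        simp only [x]; ring
      have h3 : ∑ j, w j * D (Z (Fin.succ j)) =
          ∑ i, (∑ j, w j * a (Fin.succ j) i) * D (Y i) := by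
        simp only [hDZ, Finset.mul_sum, Finset.sum_mul, mul_assoc]
        exact Finset.sum_comm
      simp only [h2, h3, hDQ, hDZ D 0, Finset.sum_neg_distrib, Finset.sum_add_distrib,
        Finset.mul_sum]
      ring
    have h4 : D φ = (D (Z 0) + algebraMap k L c * D Q + ∑ i, x i * D (Y i) +
        ∑ j, w j * D (Z (Fin.succ j))) + (∑ i, Y i * D (x i) + ∑ j, Z (Fin.succ j) * D (w j)) := by
      simp only [φ, y0, map_add, map_sum, hDc, hDmul, Finset.sum_add_distrib]
      ring
    rw [h4, h1, zero_add]
  obtain ⟨δ', hδ'⟩ := exists_dual_derivations (Sum.elim x w) hxw (by simpa using hcard)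
  have hφ1 : ∀ i, δ' (Sum.inl i) φ = Y i := by
    intro i
    have h1 : ∀ l, δ' (Sum.inl i) (x l) = if i = l then 1 else 0 := fun l =>
      (hδ' (Sum.inl i) (Sum.inl l)).trans (by simp)
    have h2 : ∀ l, δ' (Sum.inl i) (w l) = 0 := fun l =>
      (hδ' (Sum.inl i) (Sum.inr l)).trans (by simp)
    rw [hDφ]
    simp [h1, h2]
  have hφ2 : ∀ j, δ' (Sum.inr j) φ = Z (Fin.succ j) := by
    intro j
    have h1 : ∀ l, δ' (Sum.inr j) (x l) = 0 := fun l =>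
      (hδ' (Sum.inr j) (Sum.inl l)).trans (by simp)
    have h2 : ∀ l, δ' (Sum.inr j) (w l) = if j = l then 1 else 0 := fun l =>
      (hδ' (Sum.inr j) (Sum.inr l)).trans (by simp)
    rw [hDφ]
    simp [h1, h2]
  have hy0 : φ - ∑ i, Sum.elim x w i * δ' i φ = y0 := by
    rw [Fintype.sum_sum_type]
    simp only [hφ1, hφ2, Sum.elim_inl, Sum.elim_inr, φ]
    ring
  have hQmem : ∀ E : IntermediateField k L, (∀ i, Y i ∈ E) → algebraMap k L c * Q ∈ E := by
    intro E hE
    refine E.mul_mem (E.algebraMap_mem c) (sum_mem fun i _ => sum_mem fun l _ => ?_)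
    exact E.mul_mem (E.algebraMap_mem _) (E.mul_mem (hE i) (hE l))
  have hKmap : (IsScalarTower.toAlgHom k K L).fieldRange =
      adjoin k (Set.range Y ∪ Set.range Z) := by
    rw [AlgHom.fieldRange_eq_map, ← hK, adjoin_map, Set.image_union, ← Set.range_comp,
      ← Set.range_comp]
    rfl
  refine ⟨Sum.elim x w, φ, δ', hxw, hδ', ?_, ?_⟩
  · let E := adjoin k (insert φ (Set.range (Sum.elim x w)))
    have hEφ : φ ∈ E := subset_adjoin _ _ (Set.mem_insert _ _)
    have hEx : ∀ i, Sum.elim x w i ∈ E := fun i =>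
      subset_adjoin _ _ (Set.mem_insert_of_mem _ ⟨i, rfl⟩)
    have hEw : ∀ j, w j ∈ E := fun j => hEx (Sum.inr j)
    -- `E` is stable under `δ'`, hence contains `Y` and `Z`, hence is stable under `δ`
    have hδ'E : ∀ i b, b ∈ E → δ' i b ∈ E := by
      intro i b hb
      have hsep := (isSeparable_adjoin_iff_forall_derivation (Sum.elim x w)).2 hxw
      have hle : Set.range (Sum.elim x w) ⊆ (E : Set L) := by rintro _ ⟨i, rfl⟩; exact hEx i
      refine (δ' i).mem_of_isSeparable (F := adjoin k (Set.range (Sum.elim x w)))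
        (adjoin_le_iff.2 hle) (fun u hu => (δ' i).mem_of_mem_adjoin E hle ?_ hu) hb
      rintro _ ⟨j, rfl⟩
      rw [hδ']
      split_ifs
      exacts [E.one_mem, E.zero_mem]
    have hEY : ∀ i, Y i ∈ E := fun i => hφ1 i ▸ hδ'E _ _ hEφ
    have hEZ' : ∀ j, Z (Fin.succ j) ∈ E := fun j => hφ2 j ▸ hδ'E _ _ hEφ
    have hEZ : ∀ j, Z j ∈ E := by
      refine Fin.cases ?_ hEZ'
      have h1 : y0 ∈ E := by
        rw [← hy0]
        exact E.sub_mem hEφ (sum_mem fun i _ => E.mul_mem (hEx i) (hδ'E _ _ hEφ))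
      have h2 := E.sub_mem h1 (hQmem E hEY)
      rwa [add_sub_cancel_right] at h2
    have hδE : ∀ i b, b ∈ E → δ i b ∈ E := by
      intro i b hb
      have hsep := (isSeparable_adjoin_iff_forall_derivation (Sum.elim Y w)).2 hyw
      have hle : Set.range (Sum.elim Y w) ⊆ (E : Set L) := by
        rintro _ ⟨i | i, rfl⟩
        exacts [hEY i, hEw i]
      refine (δ i).mem_of_isSeparable (F := adjoin k (Set.range (Sum.elim Y w)))
        (adjoin_le_iff.2 hle) (fun u hu => (δ i).mem_of_mem_adjoin E hle ?_ hu) hb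
      rintro _ ⟨j, rfl⟩
      rw [hδ]
      split_ifs
      exacts [E.one_mem, E.zero_mem]
    have hEK : ∀ b : K, algebraMap K L b ∈ E := by
      intro b
      have h1 : adjoin k (Set.range Y ∪ Set.range Z) ≤ E := by
        rw [adjoin_le_iff]
        rintro _ (⟨i, rfl⟩ | ⟨j, rfl⟩)
        exacts [hEY i, hEZ j]
      rw [← hKmap] at h1
      exact h1 ⟨b, rfl⟩
    refine top_le_iff.1 fun u _ => ?_
    have hu : u ∈ adjoin K ((Set.range fun ji : Fin (e + 1) × Fin r =>
      δ (Sum.inl ji.2) (algebraMap K L (z ji.1))) ∪ Set.range w) := hw ▸ mem_top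
    induction hu using adjoin_induction with
    | mem v hv =>
      rcases hv with ⟨⟨j, i⟩, rfl⟩ | ⟨j, rfl⟩
      exacts [hδE _ _ (hEZ j), hEw j]
    | algebraMap b => exact hEK b
    | add _ _ _ _ h1 h2 => exact E.add_mem (h1 mem_top) (h2 mem_top)
    | inv _ _ h => exact E.inv_mem (h mem_top)
    | mul _ _ _ _ h1 h2 => exact E.mul_mem (h1 mem_top) (h2 mem_top)
  · rw [hy0, hKmap]
    apply le_antisymm
    · have hYm : ∀ i, Y i ∈ adjoin k (Set.range Y ∪ Set.range Z) := fun i =>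
        subset_adjoin _ _ (Or.inl ⟨i, rfl⟩)
      have hZm : ∀ j, Z j ∈ adjoin k (Set.range Y ∪ Set.range Z) := fun j =>
        subset_adjoin _ _ (Or.inr ⟨j, rfl⟩)
      rw [adjoin_le_iff]
      rintro _ (rfl | ⟨i | j, rfl⟩)
      · exact add_mem (hZm 0) (hQmem _ hYm)
      · have h1 := hYm i
        rwa [← hφ1 i] at h1
      · have h1 := hZm (Fin.succ j)
        rwa [← hφ2 j] at h1
    · let E := adjoin k (insert y0 (Set.range fun i => δ' i φ))
      have hYm : ∀ i, Y i ∈ E := fun i =>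
        subset_adjoin _ _ (Or.inr ⟨Sum.inl i, hφ1 i⟩)
      have hZm : ∀ j, Z j ∈ E := by
        refine Fin.cases ?_ fun j => subset_adjoin _ _ (Or.inr ⟨Sum.inr j, hφ2 j⟩)
        have h1 : y0 ∈ E := subset_adjoin _ _ (Or.inl rfl)
        have h2 := E.sub_mem h1 (hQmem E hYm)
        rwa [add_sub_cancel_right] at h2
      rw [adjoin_le_iff]
      rintro _ (⟨i, rfl⟩ | ⟨j, rfl⟩)
      exacts [hYm i, hZm j]

/-- If `L / K` is inseparable and `2 ≠ 0` or the rank of `δ_{L/K}` is even, there are coordinates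
`x` of `L / k` and `φ ∈ L` with `k(x, φ) = L` such that the Legendre transform of `φ` generates
`K`. -/
theorem exists_legendre_coordinates [IsAlgClosed k] (p : ℕ) [ExpChar k p]
    [Algebra.EssFiniteType k K] [Algebra.EssFiniteType k L] (hinsep : ¬ IsSeparablyGenerated K L)
    (n : ℕ) (hn : Algebra.trdeg k L = n) (hr : (2 : k) ≠ 0 ∨ Even (deltaRank k K L)) :
    ∃ (x : Fin n → L) (φ : L) (δ : Fin n → Derivation k L L),
      (∀ D : Derivation k L L, (∀ i, D (x i) = 0) → D = 0) ∧
      (∀ i j, δ i (x j) = if i = j then 1 else 0) ∧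
      adjoin k (insert φ (Set.range x)) = ⊤ ∧
      adjoin k (insert (φ - ∑ i, x i * δ i φ) (Set.range fun i => δ i φ)) =
        (IsScalarTower.toAlgHom k K L).fieldRange := by
  have : Infinite k := IsAlgClosed.instInfinite
  have hfr := finrank_kaehlerDifferential (k := k) (L := L)
  obtain ⟨e, y, w₀, hy, hli, hcard⟩ := exists_adapted_coordinates k K L
  let r := deltaRank k K L
  let Y : Fin r → L := fun i => algebraMap K L (y i)
  have hyw₀ : ∀ D : Derivation k L L, (∀ i, D (Sum.elim Y w₀ i) = 0) → D = 0 := by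
    rw [forall_derivation_iff_span_eq_top]
    have h1 : (fun i => D k L (Sum.elim Y w₀ i)) =
        Sum.elim (fun i => D k L (algebraMap K L (y i))) (D k L ∘ w₀) := by
      ext (i | i) <;> rfl
    rw [h1]
    apply hli.span_eq_top_of_card_eq_finrank'
    rw [← hcard]; simp
  have htr : Algebra.trdeg K L < e := by
    refine trdeg_lt_of_not_isSeparablyGenerated (k := k) (y := y) (w := w₀)
      (fun D h1 h2 => hyw₀ D ?_) hinsep
    rintro (i | j)
    exacts [h1 i, h2 j]
  obtain ⟨z, hz⟩ : ∃ z : Fin (e + 1) → K, adjoin k (Set.range y ∪ Set.range z) = ⊤ := by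
    refine exists_adjoin_range_union_range_eq_top (r := r) ?_ ?_
    · have h1 : LinearIndependent L fun i => D k L (algebraMap K L (y i)) :=
        hli.comp Sum.inl Sum.inl_injective
      have h2 := h1.restrict_scalars' K
      refine LinearIndependent.of_comp (KaehlerDifferential.map k k K L) ?_
      convert h2 using 1
      ext i
      simp
    · have h1 := lift_trdeg_add_eq k K L
      rw [← hfr, ← hcard, Cardinal.lift_natCast] at h1
      have h2 := le_self_add.trans h1.le
      rwa [Cardinal.lift_le_nat_iff] at h2
  obtain ⟨δ₀, hδ₀⟩ := exists_dual_derivations (Sum.elim Y w₀) hyw₀ (by simpa using hcard)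
  have hδ₀K : ∀ m z, δ₀ (Sum.inr m) (algebraMap K L z) = 0 := fun m =>
    hy _ fun i => (hδ₀ (Sum.inr m) (Sum.inl i)).trans (by simp)
  have hDK : ∀ (D : Derivation k L L) z,
      D (algebraMap K L z) = ∑ i, D (Y i) * δ₀ (Sum.inl i) (algebraMap K L z) := by
    intro D z
    rw [D.apply_eq_sum_dual hyw₀ hδ₀, Fintype.sum_sum_type]
    simp only [Sum.elim_inl, hδ₀K, mul_zero, Finset.sum_const_zero, add_zero]
  let a : Fin (e + 1) × Fin r → L := fun ji => δ₀ (Sum.inl ji.2) (algebraMap K L (z ji.1))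
  let F := adjoin K (Set.range a)
  have : IsScalarTower k F L := .of_algebraMap_eq fun c => by
    rw [IsScalarTower.algebraMap_apply k K F, IsScalarTower.algebraMap_apply k K L]; rfl
  have : Infinite F := Infinite.of_injective _ (algebraMap k F).injective
  have : ExpChar F p := expChar_of_injective_algebraMap (algebraMap k F).injective p
  have : Algebra.EssFiniteType F L := .of_comp k F L
  have hdep : ¬ AlgebraicIndependent F w₀ := by
    intro h
    have h1 := (h.restrictScalars (algebraMap K F).injective).lift_cardinalMk_le_trdeg
    rw [Cardinal.mk_fin, Cardinal.lift_natCast, Cardinal.nat_le_lift_iff] at h1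
    exact absurd h1 (not_le.2 htr)
  have hsep : Algebra.IsSeparable (adjoin F (Set.range w₀)) L := by
    have : Algebra.IsSeparable ((adjoin F (Set.range w₀)).restrictScalars k) L := by
      rw [isSeparable_iff_forall_derivation]
      intro D hD
      apply hyw₀ D
      rintro (i | j)
      · exact hD _ ((adjoin F (Set.range w₀)).algebraMap_mem (algebraMap K F (y i)))
      · exact hD _ (subset_adjoin F _ ⟨j, rfl⟩)
    exact this
  -- after the change of one member of `w₀` it generates `L` over `F = K(a)`
  obtain ⟨i₀, γ, hγ⟩ := exists_adjoin_update_eq_top p hdep hsep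
  let w := Function.update w₀ i₀ γ
  have haw : adjoin K (Set.range a ∪ Set.range w) = ⊤ := by
    rw [← adjoin_adjoin_left, hγ, restrictScalars_top]
  -- `(Y, w)` are still coordinates, since a derivation that kills `K` kills `a`
  have hyw : ∀ D : Derivation k L L, (∀ i, D (Sum.elim Y w i) = 0) → D = 0 := by
    intro D hD
    have hDK0 := hy D fun i => hD (Sum.inl i)
    ext u
    have hu : u ∈ adjoin K (Set.range a ∪ Set.range w) := haw ▸ mem_top
    refine D.eq_zero_of_mem_adjoin_of_tower hDK0 ?_ hu
    rintro _ (⟨⟨j, i⟩, rfl⟩ | ⟨j, rfl⟩)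
    · rw [D.apply_eq_sum_dual hyw₀ hδ₀, Fintype.sum_sum_type]
      have h1 : ∀ m, δ₀ (Sum.inr m) (a (j, i)) = 0 := fun m => by
        rw [Derivation.dual_comm hyw₀ hδ₀, hδ₀K, map_zero]
      have h2 : ∀ i, D (Y i) = 0 := fun i => hD (Sum.inl i)
      simp [h1, h2]
    · exact hD (Sum.inr j)
  obtain ⟨δ, hδ⟩ := exists_dual_derivations (Sum.elim Y w) hyw (by simpa using hcard)
  -- on `K` the derivations dual to `Y` do not depend on the choice of `w`
  have hδK : ∀ i z, δ (Sum.inl i) (algebraMap K L z) = δ₀ (Sum.inl i) (algebraMap K L z) := by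
    intro i z
    have h1 : ∀ l, δ (Sum.inl i) (Y l) = if i = l then 1 else 0 := fun l =>
      (hδ (Sum.inl i) (Sum.inl l)).trans (by simp)
    rw [hDK]
    simp [h1]
  obtain ⟨A, hA⟩ := exists_isUnit_det_add_transpose k r hr
  obtain ⟨x, φ, δ', h1, h2, h3, h4⟩ := exists_legendre_coordinates_of_frame hcard hyw hy hz hδ
    (by simp only [hδK]; exact haw) hA
  obtain ⟨ε⟩ : Nonempty (Fin n ≃ Fin r ⊕ Fin e) := by
    rw [← hfr, Nat.cast_inj, ← hcard] at hn
    exact ⟨(finCongr hn.symm).trans finSumFinEquiv.symm⟩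
  refine ⟨x ∘ ε, φ, δ' ∘ ε, fun D hD => h1 D fun i => ?_, fun i j => ?_, ?_, ?_⟩
  · simpa using hD (ε.symm i)
  · simp [h2]
  · rw [ε.surjective.range_comp, h3]
  · rw [← h4]
    congr 2
    · congr 1
      exact ε.sum_comp fun i => x i * δ' i φ
    · exact ε.surjective.range_comp fun i => δ' i φ

end Legendre

/-! ### The projective closure of a point with values in a field -/

section Homogeneous

theorem MvPolynomial.IsHomogeneous.aeval_mul_left {k R σ : Type*} [CommRing k] [CommRing R]
    [Algebra k R] {F : MvPolynomial σ k} {d : ℕ} (hF : F.IsHomogeneous d) (c : R) (s : σ → R) :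
    MvPolynomial.aeval (fun i => c * s i) F = c ^ d * MvPolynomial.aeval s F := by
  rw [aeval_def, aeval_def, eval₂_eq, eval₂_eq, Finset.mul_sum]
  refine Finset.sum_congr rfl fun m hm => ?_
  simp only [mul_pow]
  rw [Finset.prod_mul_distrib, Finset.prod_pow_eq_pow_sum, ← hF.degree_eq_sum_deg_support hm]
  ring

theorem MvPolynomial.IsHomogeneous.eval_mul_left {k σ : Type*} [CommRing k] {F : MvPolynomial σ k}
    {d : ℕ} (hF : F.IsHomogeneous d) (c : k) (s : σ → k) :
    MvPolynomial.eval (fun i => c * s i) F = c ^ d * MvPolynomial.eval s F :=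
  hF.aeval_mul_left c s

variable {k L : Type*} [Field k] [Field L] [Algebra k L]

/-- The value of a derivation at a polynomial expression, by the chain rule. -/
theorem Derivation.apply_aeval {σ : Type*} [Fintype σ] (D : Derivation k L L) (s : σ → L)
    (F : MvPolynomial σ k) : D (aeval s F) = ∑ l, aeval s (pderiv l F) * D (s l) := by
  classical
  induction F using MvPolynomial.induction_on with
  | C a => simp
  | add p q hp hq => simp [hp, hq, add_mul, Finset.sum_add_distrib]
  | mul_X p i hp =>
    rw [map_mul, D.leibniz, hp, aeval_X]
    simp only [smul_eq_mul, pderiv_mul, map_add, map_mul, aeval_X, pderiv_X, add_mul,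
      Finset.sum_add_distrib, Finset.mul_sum]
    rw [add_comm]
    congr 1
    · exact Finset.sum_congr rfl fun l _ => by ring
    · rw [Finset.sum_eq_single i]
      · simp
      · intro l _ hl
        simp [Pi.single_eq_of_ne' hl]
      · simp

/-- If one of the coordinates of `t` is `1`, every element of `k(t)` is a quotient of values at `t`
of homogeneous polynomials of the same degree. -/
theorem exists_eq_aeval_div_aeval {σ : Type*} {t : σ → L} {i₀ : σ} (ht : t i₀ = 1) {u : L}
    (hu : u ∈ IntermediateField.adjoin k (Set.range t)) :
    ∃ (d : ℕ) (A B : MvPolynomial σ k), A.IsHomogeneous d ∧ B.IsHomogeneous d ∧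
      aeval t B ≠ 0 ∧ u = aeval t A / aeval t B := by
  induction hu using IntermediateField.adjoin_induction with
  | mem x hx =>
    obtain ⟨i, rfl⟩ := hx
    exact ⟨1, X i, X i₀, isHomogeneous_X _ _, isHomogeneous_X _ _, by simp [ht], by simp [ht]⟩
  | algebraMap c =>
    exact ⟨0, C c, 1, isHomogeneous_C _ _, isHomogeneous_one _ _, by simp, by simp⟩
  | add x y _ _ h1 h2 =>
    obtain ⟨d, A, B, hA, hB, hB0, rfl⟩ := h1
    obtain ⟨e, A', B', hA', hB', hB0', rfl⟩ := h2
    refine ⟨d + e, A * B' + B * A', B * B', (hA.mul hB').add (hB.mul hA'), hB.mul hB', ?_, ?_⟩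
    · rw [map_mul]; exact mul_ne_zero hB0 hB0'
    · rw [map_add, map_mul, map_mul, map_mul, div_add_div _ _ hB0 hB0']
  | inv x _ h =>
    obtain ⟨d, A, B, hA, hB, hB0, rfl⟩ := h
    by_cases hA0 : aeval t A = 0
    · exact ⟨d, 0, B, isHomogeneous_zero _ _ _, hB, hB0, by simp [hA0]⟩
    · exact ⟨d, B, A, hB, hA, hA0, inv_div _ _⟩
  | mul x y _ _ h1 h2 =>
    obtain ⟨d, A, B, hA, hB, hB0, rfl⟩ := h1
    obtain ⟨e, A', B', hA', hB', hB0', rfl⟩ := h2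
    refine ⟨d + e, A * A', B * B', hA.mul hA', hB.mul hB', ?_, ?_⟩
    · rw [map_mul]; exact mul_ne_zero hB0 hB0'
    · rw [map_mul, map_mul, div_mul_div_comm]

/-- A common denominator for a finite family of elements of `k(t)`. -/
theorem exists_common_denominator {σ ι : Type*} [Fintype ι] {t : σ → L} {i₀ : σ} (ht : t i₀ = 1)
    {u : ι → L} (hu : ∀ i, u i ∈ IntermediateField.adjoin k (Set.range t)) :
    ∃ (d : ℕ) (q : MvPolynomial σ k) (A : ι → MvPolynomial σ k), q.IsHomogeneous d ∧
      aeval t q ≠ 0 ∧ ∀ i, (A i).IsHomogeneous d ∧ aeval t (A i) = u i * aeval t q := by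
  classical
  choose d A B hA hB hB0 h using fun i => exists_eq_aeval_div_aeval ht (hu i)
  refine ⟨∑ i, d i, ∏ i, B i, fun i => A i * ∏ j ∈ Finset.univ.erase i, B j,
    IsHomogeneous.prod _ _ _ fun i _ => hB i, ?_, fun i => ⟨?_, ?_⟩⟩
  · rw [map_prod]; exact Finset.prod_ne_zero_iff.2 fun i _ => hB0 i
  · rw [← Finset.add_sum_erase _ _ (Finset.mem_univ i)]
    exact (hA i).mul (IsHomogeneous.prod _ _ _ fun i _ => hB i)
  · rw [h i, ← Finset.mul_prod_erase _ _ (Finset.mem_univ i), map_mul, map_mul, ← mul_assoc,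
      div_mul_cancel₀ _ (hB0 i)]

/-- Subfields with the same image under field homomorphisms are isomorphic. -/
noncomputable def equivOfMapEqFieldRange {M Ω : Type*} [Field M] [Field Ω] [Algebra k M]
    [Algebra k Ω] {S : IntermediateField k M} {f : M →ₐ[k] Ω} {g : L →ₐ[k] Ω}
    (h : S.map f = g.fieldRange) : S ≃ₐ[k] L :=
  ((IntermediateField.equivMap S f).trans (IntermediateField.equivOfEq h)).trans
    g.equivFieldRange.symm

theorem apply_equivOfMapEqFieldRange {M Ω : Type*} [Field M] [Field Ω] [Algebra k M]
    [Algebra k Ω] {S : IntermediateField k M} {f : M →ₐ[k] Ω} {g : L →ₐ[k] Ω}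
    (h : S.map f = g.fieldRange) (x : S) : g (equivOfMapEqFieldRange h x) = f x :=
  congrArg Subtype.val (g.equivFieldRange.apply_symm_apply
    (IntermediateField.equivOfEq h (IntermediateField.equivMap S f x)))

end Homogeneous

namespace ProjectiveVariety

section OfPoint

variable {k L : Type*} [Field k] [Field L] [Algebra k L] {N : ℕ} (t : Fin (N + 1) → L)

/-- The homomorphism `F ↦ F(t T)` of evaluation at the generic point of the affine cone over the
closure of the `L`-valued point `t`. -/
noncomputable def coneEval : MvPolynomial (Fin (N + 1)) k →ₐ[k] Polynomial L :=
  aeval fun i => Polynomial.X * Polynomial.C (t i)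

theorem coneEval_of_isHomogeneous {F : MvPolynomial (Fin (N + 1)) k} {d : ℕ}
    (hF : F.IsHomogeneous d) :
    coneEval t F = Polynomial.X ^ d * Polynomial.C (aeval t F) := by
  rw [coneEval, hF.aeval_mul_left]
  congr 1
  exact aeval_algebraMap_apply (Polynomial L) t F

/-- Evaluation at the generic point of the cone separates the homogeneous components. -/
theorem coeff_coneEval (F : MvPolynomial (Fin (N + 1)) k) (d : ℕ) :
    (coneEval t F).coeff d = aeval t (homogeneousComponent d F) := by
  have h : coneEval t F = ∑ i ∈ Finset.range (F.totalDegree + 1),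
      Polynomial.X ^ i * Polynomial.C (aeval t (homogeneousComponent i F)) := by
    conv_lhs => rw [← sum_homogeneousComponent F]
    rw [map_sum]
    exact Finset.sum_congr rfl fun i _ =>
      coneEval_of_isHomogeneous t (homogeneousComponent_isHomogeneous i F)
  rw [h, Polynomial.finsetSum_coeff]
  simp only [Polynomial.coeff_mul_C, Polynomial.coeff_X_pow, ite_mul, one_mul, zero_mul,
    Finset.sum_ite_eq, Finset.mem_range]
  split_ifs with hd
  · rfl
  · rw [homogeneousComponent_eq_zero _ _ (by omega), map_zero]

variable (ht : t 0 = 1)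

/-- The closure in `ℙ^N` of the `L`-valued point `t = (1 : t_1 : … : t_N)`. -/
noncomputable def ofPoint : ProjectiveVariety k N where
  ideal := RingHom.ker (coneEval (k := k) t)
  isHomogeneous := by
    intro d F hF
    have h1 : (DirectSum.decompose (homogeneousSubmodule (Fin (N + 1)) k) F d :
        MvPolynomial (Fin (N + 1)) k) = homogeneousComponent d F :=
      decomposition.decompose'_apply F d
    rw [h1, RingHom.mem_ker]
    change coneEval t _ = 0
    rw [coneEval_of_isHomogeneous t (homogeneousComponent_isHomogeneous d F), ← coeff_coneEval]
    have h2 : coneEval t F = 0 := hF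
    rw [h2, Polynomial.coeff_zero, Polynomial.C_0, mul_zero]
  isPrime := RingHom.ker_isPrime _
  not_irrelevant := ⟨0, fun h => by
    have h1 : coneEval (k := k) t (X 0) = 0 := h
    rw [coneEval, aeval_X, ht] at h1
    simp at h1⟩

variable {t}

theorem mem_ideal_ofPoint_iff {F : MvPolynomial (Fin (N + 1)) k} {d : ℕ} (hF : F.IsHomogeneous d) :
    F ∈ (ofPoint t ht : ProjectiveVariety k N).ideal ↔ aeval t F = 0 := by
  have h : F ∈ (ofPoint t ht : ProjectiveVariety k N).ideal ↔ coneEval t F = 0 := Iff.rfl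
  rw [h, coneEval_of_isHomogeneous t hF, mul_eq_zero, Polynomial.C_eq_zero]
  exact or_iff_right (pow_ne_zero _ Polynomial.X_ne_zero)

theorem homogeneousComponent_mem_ideal (X : ProjectiveVariety k N)
    {F : MvPolynomial (Fin (N + 1)) k} (hF : F ∈ X.ideal) (d : ℕ) :
    homogeneousComponent d F ∈ X.ideal := by
  have h1 : (DirectSum.decompose (homogeneousSubmodule (Fin (N + 1)) k) F d :
      MvPolynomial (Fin (N + 1)) k) = homogeneousComponent d F :=
    decomposition.decompose'_apply F d
  rw [← h1]
  exact X.isHomogeneous d hF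

/-- The embedding of the homogeneous coordinate ring into `L[T]`. -/
noncomputable def coordEval : (ofPoint t ht : ProjectiveVariety k N).CoordRing →ₐ[k] Polynomial L :=
  Ideal.Quotient.liftₐ (ofPoint t ht : ProjectiveVariety k N).ideal (coneEval t) fun _ h => h

theorem coordEval_injective :
    Function.Injective (coordEval ht : (ofPoint t ht : ProjectiveVariety k N).CoordRing → _) := by
  rw [injective_iff_map_eq_zero]
  intro a ha
  obtain ⟨F, rfl⟩ := Ideal.Quotient.mk_surjective a
  exact Ideal.Quotient.eq_zero_iff_mem.2 ha

/-- The embedding of the homogeneous coordinate ring into `L(T)`. -/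
noncomputable def coordFracEval : (ofPoint t ht : ProjectiveVariety k N).CoordRing →ₐ[k]
    FractionRing (Polynomial L) :=
  (IsScalarTower.toAlgHom k (Polynomial L) (FractionRing (Polynomial L))).comp (coordEval ht)

theorem coordFracEval_injective : Function.Injective
    (coordFracEval ht : (ofPoint t ht : ProjectiveVariety k N).CoordRing → _) :=
  (IsFractionRing.injective (Polynomial L) (FractionRing (Polynomial L))).comp
    (coordEval_injective ht)

/-- The embedding of the fraction field of the homogeneous coordinate ring into `L(T)`. -/
noncomputable def fracEval : FractionRing (ofPoint t ht : ProjectiveVariety k N).CoordRing →ₐ[k]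
    FractionRing (Polynomial L) :=
  IsFractionRing.liftAlgHom (coordFracEval_injective ht)

theorem fracEval_toFrac (F : MvPolynomial (Fin (N + 1)) k) :
    fracEval ht ((ofPoint t ht).toFrac F) = algebraMap (Polynomial L) _ (coneEval t F) := by
  rw [fracEval, IsFractionRing.liftAlgHom_apply]
  exact IsFractionRing.lift_algebraMap _ _

theorem fracEval_div {A B : MvPolynomial (Fin (N + 1)) k} {d : ℕ} (hA : A.IsHomogeneous d)
    (hB : B.IsHomogeneous d) :
    fracEval ht ((ofPoint t ht).toFrac A / (ofPoint t ht).toFrac B) =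
      algebraMap L (FractionRing (Polynomial L)) (aeval t A / aeval t B) := by
  rw [map_div₀, fracEval_toFrac, fracEval_toFrac, coneEval_of_isHomogeneous t hA,
    coneEval_of_isHomogeneous t hB, map_mul, map_mul, mul_div_mul_left, map_div₀]
  · rfl
  · rw [map_pow]
    refine pow_ne_zero _ fun h => Polynomial.X_ne_zero (R := L) ?_
    exact (IsFractionRing.injective (Polynomial L) (FractionRing (Polynomial L)))
      (h.trans (map_zero _).symm)

variable (htop : IntermediateField.adjoin k (Set.range t) = ⊤)

include htop in
theorem map_fracEval_functionField :
    (ofPoint t ht : ProjectiveVariety k N).functionField.map (fracEval ht) =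
      (IsScalarTower.toAlgHom k L (FractionRing (Polynomial L))).fieldRange := by
  ext u
  constructor
  · rintro ⟨h, ⟨d, A, B, hA, hB, hB0, rfl⟩, rfl⟩
    exact ⟨_, (fracEval_div ht hA hB).symm⟩
  · rintro ⟨v, rfl⟩
    obtain ⟨d, A, B, hA, hB, hB0, rfl⟩ := exists_eq_aeval_div_aeval ht (k := k) (u := v)
      (htop ▸ IntermediateField.mem_top)
    refine ⟨_, ⟨d, A, B, hA, hB, fun h => hB0 ?_, rfl⟩, fracEval_div ht hA hB⟩
    exact (mem_ideal_ofPoint_iff ht hB).1 h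

/-- The function field of the closure of a point `t` with `k(t) = L` is `L`. -/
noncomputable def functionFieldEquiv :
    (ofPoint t ht : ProjectiveVariety k N).functionField ≃ₐ[k] L :=
  equivOfMapEqFieldRange (map_fracEval_functionField ht htop)

theorem functionFieldEquiv_apply {A B : MvPolynomial (Fin (N + 1)) k} {d : ℕ}
    (hA : A.IsHomogeneous d) (hB : B.IsHomogeneous d)
    (h : (ofPoint t ht : ProjectiveVariety k N).functionField)
    (hh : (h : FractionRing (ofPoint t ht : ProjectiveVariety k N).CoordRing) =
      (ofPoint t ht).toFrac A / (ofPoint t ht).toFrac B) :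
    functionFieldEquiv ht htop h = aeval t A / aeval t B := by
  have h1 := apply_equivOfMapEqFieldRange (map_fracEval_functionField ht htop) h
  rw [hh, fracEval_div ht hA hB] at h1
  exact (algebraMap L (FractionRing (Polynomial L))).injective h1

include htop in
theorem dim_ofPoint {n : ℕ} (hn : Algebra.trdeg k L = n) :
    (ofPoint t ht : ProjectiveVariety k N).dim = n := by
  have h := (functionFieldEquiv (k := k) ht htop).lift_trdeg_eq
  rw [dim]
  have h1 := congrArg Cardinal.toNat h
  rw [Cardinal.toNat_lift, Cardinal.toNat_lift, hn, Cardinal.toNat_natCast] at h1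
  exact h1

end OfPoint

end ProjectiveVariety

/-! ### Plücker coordinates of tangent spaces and the Gauss image -/

namespace ProjGrassmannian

/-- The Plücker coordinates of a subspace may be computed from spanning rows in reduced echelon
form. -/
theorem exists_plucker_eq {k : Type*} [Field k] {N r : ℕ} (W : ProjGrassmannian k N r)
    {v : Fin r → Fin (N + 1) → k} {J : Fin r → Fin (N + 1)}
    (hW : ∀ u ∈ W.1, u = ∑ i, u (J i) • v i) :
    ∃ g : k, g ≠ 0 ∧ ∀ I, W.plucker I = g * Matrix.det (Matrix.of fun a b => v a (I b)) := by
  let B := Module.finBasisOfFinrankEq k W.1 W.2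
  let G : Matrix (Fin r) (Fin r) k := Matrix.of fun a i => (B a : Fin (N + 1) → k) (J i)
  refine ⟨G.det, fun h => ?_, fun I => ?_⟩
  · obtain ⟨c, hc, hG⟩ := Matrix.exists_vecMul_eq_zero_iff.2 h
    apply hc
    have h1 : ∀ i, ((∑ a, c a • B a : W.1) : Fin (N + 1) → k) (J i) = 0 := fun i => by
      rw [AddSubmonoidClass.coe_finsetSum, Finset.sum_apply]
      exact congrFun hG i
    have h2 : ∑ a, c a • B a = 0 := by
      apply Subtype.ext
      rw [hW _ (∑ a, c a • B a : W.1).2]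
      simp [h1]
    exact funext (Fintype.linearIndependent_iff.1 B.linearIndependent c h2)
  · rw [← Matrix.det_mul]
    unfold plucker
    congr 1
    ext a b
    simp only [Matrix.mul_apply, Matrix.of_apply, G]
    conv_lhs => rw [hW _ (Module.finBasisOfFinrankEq k W.1 W.2 a).2]
    rw [Finset.sum_apply]
    rfl

end ProjGrassmannian

namespace ProjectiveVariety

section Points

variable {k : Type*} [Field k] {N : ℕ} (X : ProjectiveVariety k N)

theorem mk_mem_points {v : Fin (N + 1) → k} (hv : v ≠ 0) (h : ∀ F ∈ X.ideal, eval v F = 0) :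
    Projectivization.mk k v hv ∈ X.points := by
  intro F hF
  obtain ⟨a, ha⟩ := Projectivization.exists_smul_eq_mk_rep k v hv
  rw [← ha, ← sum_homogeneousComponent F, map_sum]
  refine Finset.sum_eq_zero fun d _ => ?_
  refine ((homogeneousComponent_isHomogeneous d F).eval_mul_left (a : k) v).trans ?_
  rw [h _ (X.homogeneousComponent_mem_ideal hF d), mul_zero]

/-- The projective Nullstellensatz. -/
theorem exists_point_eval_ne_zero [IsAlgClosed k] {E : MvPolynomial (Fin (N + 1)) k} {d : ℕ}
    (hE : E.IsHomogeneous d) (hEX : E ∉ X.ideal) : ∃ x ∈ X.points, eval x.rep E ≠ 0 := by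
  obtain ⟨i, hi⟩ := X.not_irrelevant
  have h1 : E * MvPolynomial.X i ∉ X.ideal := fun h => (X.isPrime.mem_or_mem h).elim hEX hi
  rw [← IsPrime.vanishingIdeal_zeroLocus (k := k) (K := k) X.ideal, mem_vanishingIdeal_iff] at h1
  push Not at h1
  obtain ⟨v, hv, hEv⟩ := h1
  rw [map_mul, aeval_X, mul_ne_zero_iff] at hEv
  have hv0 : v ≠ 0 := fun h => hEv.2 (by rw [h]; rfl)
  refine ⟨_, X.mk_mem_points hv0 fun F hF => hv F hF, ?_⟩
  obtain ⟨a, ha⟩ := Projectivization.exists_smul_eq_mk_rep k v hv0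
  rw [← ha]
  refine (hE.eval_mul_left (a : k) v).trans_ne ?_
  exact mul_ne_zero (pow_ne_zero _ a.ne_zero) hEv.1

theorem isNondegenerate_of_linear_notMem [IsAlgClosed k]
    (h : ∀ c : Fin (N + 1) → k, ∑ i, C (c i) * MvPolynomial.X i ∈ X.ideal → c = 0) :
    X.IsNondegenerate := by
  rintro ⟨c, hc, hx⟩
  apply hc
  apply h
  by_contra hE
  have hhom : (∑ i, C (c i) * MvPolynomial.X i : MvPolynomial (Fin (N + 1)) k).IsHomogeneous 1 :=
    IsHomogeneous.sum _ _ _ fun i _ => isHomogeneous_C_mul_X _ _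
  obtain ⟨x, hxX, hx0⟩ := X.exists_point_eval_ne_zero hhom hE
  apply hx0
  simpa using hx x hxX

end Points

/-- A frame of the embedded tangent spaces of `X` over an open subset `q ≠ 0`: the matrix
`β i l / q` of rational functions on `X`, whose columns with the indices `J` form the identity
matrix, has rows which span the embedded tangent space at each point with `q ≠ 0`. -/
structure TangentFrame {k : Type*} [Field k] {N : ℕ} (X : ProjectiveVariety k N) (r : ℕ) where
  /-- The columns of the identity submatrix. -/
  J : Fin r → Fin (N + 1)
  /-- The common degree of the numerators and the denominator. -/
  d : ℕ
  /-- The common denominator. -/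
  q : MvPolynomial (Fin (N + 1)) k
  /-- The numerators. -/
  β : Fin r → Fin (N + 1) → MvPolynomial (Fin (N + 1)) k
  q_isHomogeneous : q.IsHomogeneous d
  β_isHomogeneous : ∀ i l, (β i l).IsHomogeneous d
  q_notMem : q ∉ X.ideal
  β_sub_mem : ∀ i l, β i (J l) - (if i = l then q else 0) ∈ X.ideal
  tangent_mem : ∀ i, ∀ F ∈ X.ideal, ∑ l, pderiv l F * β i l ∈ X.ideal
  eq_zero_of_mem_tangentSpace : ∀ x ∈ X.points, eval x.rep q ≠ 0 →
    ∀ v ∈ X.tangentSpace x, (∀ i, v (J i) = 0) → v = 0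

namespace TangentFrame

variable {k : Type*} [Field k] {N : ℕ} {X : ProjectiveVariety k N} {r : ℕ} (T : TangentFrame X r)

/-- The `i`-th row of the frame at the point `x`. -/
noncomputable def row (x : ℙ k (Fin (N + 1) → k)) (i : Fin r) : Fin (N + 1) → k :=
  fun l => eval x.rep (T.β i l) / eval x.rep T.q

/-- The entry `β i l / q` of the frame as a rational function on `X`. -/
noncomputable def entry (i : Fin r) (l : Fin (N + 1)) : X.functionField :=
  ⟨X.toFrac (T.β i l) / X.toFrac T.q, T.d, T.β i l, T.q, T.β_isHomogeneous i l, T.q_isHomogeneous,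
    T.q_notMem, rfl⟩

section AtPoint

variable {x : ℙ k (Fin (N + 1) → k)} (hx : x ∈ X.points) (hq : eval x.rep T.q ≠ 0)

include hx hq

theorem row_J (i l : Fin r) : T.row x i (T.J l) = if i = l then 1 else 0 := by
  have h := hx _ (T.β_sub_mem i l)
  rw [map_sub, sub_eq_zero] at h
  rw [row, h]
  split_ifs
  · exact div_self hq
  · rw [map_zero, zero_div]

omit hq in
theorem row_mem (i : Fin r) : T.row x i ∈ X.tangentSpace x := by
  intro F hF
  have h := hx _ (T.tangent_mem i F hF)
  rw [map_sum] at h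
  simp only [row, ← mul_div_assoc, ← Finset.sum_div]
  rw [div_eq_zero_iff]
  left
  simpa using h

theorem eq_sum_row {v : Fin (N + 1) → k} (hv : v ∈ X.tangentSpace x) :
    v = ∑ i, v (T.J i) • T.row x i := by
  rw [← sub_eq_zero]
  refine T.eq_zero_of_mem_tangentSpace x hx hq _ (Submodule.sub_mem _ hv
    (Submodule.sum_mem _ fun i _ => Submodule.smul_mem _ _ (T.row_mem hx i))) fun l => ?_
  simp [Finset.sum_apply, T.row_J hx hq]

theorem finrank_tangentSpace : Module.finrank k (X.tangentSpace x) = r := by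
  have hli : LinearIndependent k (T.row x) := by
    rw [Fintype.linearIndependent_iff]
    intro c hc i
    have h := congrFun hc (T.J i)
    simpa [Finset.sum_apply, T.row_J hx hq] using h
  have hspan : X.tangentSpace x = Submodule.span k (Set.range (T.row x)) := by
    apply le_antisymm
    · intro v hv
      rw [T.eq_sum_row hx hq hv]
      exact Submodule.sum_mem _ fun i _ => Submodule.smul_mem _ _ (Submodule.subset_span ⟨i, rfl⟩)
    · rw [Submodule.span_le]
      rintro _ ⟨i, rfl⟩
      exact T.row_mem hx i
  rw [hspan, finrank_span_eq_card hli, Fintype.card_fin]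

end AtPoint

/-- The numerators of the Plücker coordinates of the tangent spaces. -/
noncomputable def minor (I : Fin r → Fin (N + 1)) : MvPolynomial (Fin (N + 1)) k :=
  Matrix.det (Matrix.of fun a b => T.β a (I b))

theorem minor_isHomogeneous (I : Fin r → Fin (N + 1)) :
    (T.minor I).IsHomogeneous (∑ _ : Fin r, T.d) := by
  rw [minor, Matrix.det_apply]
  refine IsHomogeneous.sum _ _ _ fun σ _ => ?_
  have h : (∏ i, T.β (σ i) (I i)).IsHomogeneous (∑ _ : Fin r, T.d) :=
    IsHomogeneous.prod _ _ _ fun i _ => T.β_isHomogeneous _ _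
  rcases Int.units_eq_one_or (Equiv.Perm.sign σ) with hs | hs <;> rw [hs]
  · rw [one_smul]; exact h
  · rw [Units.neg_smul, one_smul]; exact h.neg

/-- A ring homomorphism maps the minors to those of the image matrix, up to the denominators. -/
theorem map_minor {E : Type*} [Field E] (f : MvPolynomial (Fin (N + 1)) k →+* E)
    (hf : f T.q ≠ 0) (I : Fin r → Fin (N + 1)) :
    f (T.minor I) = f T.q ^ r *
      Matrix.det (Matrix.of fun a b => f (T.β a (I b)) / f T.q) := by
  rw [minor, RingHom.map_det]
  have h : f.mapMatrix (Matrix.of fun a b => T.β a (I b)) =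
      f T.q • Matrix.of fun a b => f (T.β a (I b)) / f T.q := by
    ext a b
    simp [mul_div_cancel₀ _ hf]
  rw [h, Matrix.det_smul, Fintype.card_fin]

variable (hr : X.dim + 1 = r)

include hr in
theorem isSmoothAt {x : ℙ k (Fin (N + 1) → k)} (hx : x ∈ X.points) (hq : eval x.rep T.q ≠ 0) :
    X.IsSmoothAt x := ⟨hx, by rw [T.finrank_tangentSpace hx hq, hr]⟩

end TangentFrame

section GaussField

variable {k : Type*} [Field k] {N : ℕ} {X : ProjectiveVariety k N}
  (T : TangentFrame X (X.dim + 1))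

theorem TangentFrame.exists_plucker_gaussMap_eq (x : {x // X.IsSmoothAt x})
    (hq : eval x.1.rep T.q ≠ 0) : ∃ g : k, g ≠ 0 ∧ ∀ I, (X.gaussMap x).plucker I =
      g * Matrix.det (Matrix.of fun a b => T.row x.1 a (I b)) :=
  (X.gaussMap x).exists_plucker_eq fun _ hu => T.eq_sum_row x.2.1 hq hu

/-- An entry of the frame is a quotient of two Plücker coordinates: the minor of the columns `J` is
`1`, and replacing the column `J i` by the column `l` gives the entry in place `(i, l)`. -/
theorem TangentFrame.entry_mem_gaussImageField (i : Fin (X.dim + 1)) (l : Fin (N + 1)) :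
    T.entry i l ∈ X.gaussImageField := by
  refine ⟨1, MvPolynomial.X (Function.update T.J i l), MvPolynomial.X T.J, isHomogeneous_X _ _,
    isHomogeneous_X _ _, T.d, T.q, T.q_isHomogeneous, T.q_notMem, fun x hq => ?_⟩
  obtain ⟨g, hg, h⟩ := T.exists_plucker_gaussMap_eq x hq
  have h1 : (Matrix.of fun a b => T.row x.1 a (T.J b)) = 1 := by
    ext a b
    rw [Matrix.of_apply, T.row_J x.2.1 hq, Matrix.one_apply]
  have h2 : (Matrix.of fun a b => T.row x.1 a (Function.update T.J i l b)) =
      (1 : Matrix _ _ k).updateCol i fun a => T.row x.1 a l := by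
    ext a b
    rw [Matrix.of_apply, Matrix.updateCol_apply]
    split_ifs with hb
    · rw [hb, Function.update_self]
    · rw [Function.update_of_ne hb, T.row_J x.2.1 hq, Matrix.one_apply]
  rw [eval_X, eval_X, h, h, h1, h2, ← Matrix.cramer_apply, Matrix.cramer_one, Matrix.det_one,
    mul_one]
  refine ⟨hg, T.d, T.β i l, T.q, T.β_isHomogeneous i l, T.q_isHomogeneous, hq, rfl, ?_⟩
  rw [mul_div_cancel_left₀ _ hg]
  rfl

/-- The Plücker coordinates of the tangent space at `x` are proportional to the values of the
minors. -/
theorem TangentFrame.exists_eval_plucker_eq (x : {x // X.IsSmoothAt x})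
    (hq : eval x.1.rep T.q ≠ 0) : ∃ g : k, g ≠ 0 ∧
      ∀ (m : ℕ) (G : MvPolynomial (Fin (X.dim + 1) → Fin (N + 1)) k), G.IsHomogeneous m →
        eval (X.gaussMap x).plucker G = g ^ m * eval x.1.rep (aeval T.minor G) := by
  obtain ⟨g, hg, h⟩ := T.exists_plucker_gaussMap_eq x hq
  refine ⟨g * (eval x.1.rep T.q ^ (X.dim + 1))⁻¹, mul_ne_zero hg (inv_ne_zero (pow_ne_zero _ hq)),
    fun m G hG => ?_⟩
  have h1 : (X.gaussMap x).plucker =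
      fun I => g * (eval x.1.rep T.q ^ (X.dim + 1))⁻¹ * eval x.1.rep (T.minor I) := by
    funext I
    rw [h, T.map_minor (eval x.1.rep) hq, mul_assoc, inv_mul_cancel_left₀ (pow_ne_zero _ hq)]
    rfl
  rw [h1, hG.eval_mul_left]
  congr 1
  exact (DFunLike.congr_fun (comp_aeval (R := k) T.minor
    (aeval x.1.rep : MvPolynomial (Fin (N + 1)) k →ₐ[k] k)) G).symm

/-- The function field of the Gauss image is generated by the entries of a tangent frame. -/
theorem TangentFrame.gaussImageField_eq [IsAlgClosed k] : X.gaussImageField =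
    IntermediateField.adjoin k (Set.range fun il : Fin (X.dim + 1) × Fin (N + 1) =>
      T.entry il.1 il.2) := by
  apply le_antisymm
  · rintro h ⟨m, G, H, hG, hH, e, D, hD, hD0, P⟩
    obtain ⟨a, A, B, hA, hB, hB0, hh⟩ := h.2
    let G' := aeval T.minor G
    let H' := aeval T.minor H
    have hG' : G'.IsHomogeneous _ := hG.aeval _ T.minor_isHomogeneous
    have hH' : H'.IsHomogeneous _ := hH.aeval _ T.minor_isHomogeneous
    have hDq : D * T.q ∉ X.ideal := fun h => (X.isPrime.mem_or_mem h).elim hD0 T.q_notMem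
    -- the value of `h` at a point of the open set is the quotient of the values of `G'` and `H'`
    have key : ∀ x ∈ X.points, eval x.rep (D * T.q) ≠ 0 → eval x.rep H' ≠ 0 ∧
        X.HasValue h x (eval x.rep G' / eval x.rep H') := by
      intro x hx hDqx
      rw [map_mul, mul_ne_zero_iff] at hDqx
      let x' : {x // X.IsSmoothAt x} := ⟨x, T.isSmoothAt rfl hx hDqx.2⟩
      obtain ⟨h1, h2⟩ := P x' hDqx.1
      obtain ⟨g, hg, h3⟩ := T.exists_eval_plucker_eq x' hDqx.2
      rw [h3 m G hG, h3 m H hH, mul_div_mul_left _ _ (pow_ne_zero _ hg)] at h2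
      rw [h3 m H hH] at h1
      exact ⟨right_ne_zero_of_mul h1, h2⟩
    have hH'0 : H' ∉ X.ideal := by
      obtain ⟨x, hx, hx0⟩ := X.exists_point_eval_ne_zero (hD.mul T.q_isHomogeneous) hDq
      exact notMem_of_eval_ne_zero hx (key x hx hx0).1
    have hrel : A * H' - B * G' ∈ X.ideal := by
      by_contra hE
      have hE' : (A * H' - B * G') * (D * T.q * B) ∉ X.ideal := fun h =>
        (X.isPrime.mem_or_mem h).elim hE fun h => (X.isPrime.mem_or_mem h).elim hDq hB0
      obtain ⟨x, hx, hx0⟩ := X.exists_point_eval_ne_zero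
        (((hA.mul hH').sub (hB.mul hG')).mul ((hD.mul T.q_isHomogeneous).mul hB)) hE'
      rw [map_mul, map_mul, mul_ne_zero_iff, mul_ne_zero_iff] at hx0
      obtain ⟨h1, h2⟩ := key x hx hx0.2.1
      have h3 := h2.unique hx ⟨a, A, B, hA, hB, hx0.2.2, hh, rfl⟩
      rw [div_eq_div_iff h1 hx0.2.2] at h3
      apply hx0.1
      rw [map_sub, map_mul, map_mul]
      linear_combination -h3
    have hhGH : (h : FractionRing X.CoordRing) = X.toFrac G' / X.toFrac H' := by
      rw [hh, div_eq_div_iff (mt (X.toFrac_eq_zero_iff B).1 hB0)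
        (mt (X.toFrac_eq_zero_iff H').1 hH'0), ← sub_eq_zero, ← map_mul, ← map_mul, ← map_sub,
        X.toFrac_eq_zero_iff, mul_comm G']
      exact hrel
    -- homogeneous fractions in the minors are fractions in the minors `μ` of the matrix of entries
    let S := IntermediateField.adjoin k
      (Set.range fun il : Fin (X.dim + 1) × Fin (N + 1) => T.entry il.1 il.2)
    let μ : (Fin (X.dim + 1) → Fin (N + 1)) → S := fun I => Matrix.det (Matrix.of fun a b =>
      (⟨T.entry a (I b), IntermediateField.subset_adjoin _ _ ⟨(a, I b), rfl⟩⟩ : S))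
    let f : S →ₐ[k] FractionRing X.CoordRing := X.functionField.val.comp S.val
    have hq0 : X.toFrac T.q ≠ 0 := mt (X.toFrac_eq_zero_iff _).1 T.q_notMem
    have hμ : ∀ I, X.toFrac (T.minor I) = X.toFrac T.q ^ (X.dim + 1) * f (μ I) := by
      intro I
      have h1 := T.map_minor X.toFrac.toRingHom hq0 I
      have h2 : f (μ I) = Matrix.det (Matrix.of fun a b =>
          X.toFrac (T.β a (I b)) / X.toFrac T.q) := by
        exact RingHom.map_det f.toRingHom _
      rw [h2]
      exact h1
    have hGμ : ∀ G : MvPolynomial (Fin (X.dim + 1) → Fin (N + 1)) k, G.IsHomogeneous m →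
        X.toFrac (aeval T.minor G) = (X.toFrac T.q ^ (X.dim + 1)) ^ m * f (aeval μ G) := by
      intro G hG
      have h1 := DFunLike.congr_fun (comp_aeval (R := k) T.minor X.toFrac) G
      have h2 := DFunLike.congr_fun (comp_aeval (R := k) μ f) G
      rw [AlgHom.comp_apply] at h1 h2
      rw [h1, h2, ← hG.aeval_mul_left]
      simp only [hμ]
    have hfin : h = ((aeval μ G / aeval μ H : S) : X.functionField) := by
      apply Subtype.ext
      rw [hhGH, hGμ G hG, hGμ H hH, mul_div_mul_left _ _ (pow_ne_zero _ (pow_ne_zero _ hq0)),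
        ← map_div₀]
      rfl
    rw [hfin]
    exact (aeval μ G / aeval μ H : S).2
  · rw [IntermediateField.adjoin_le_iff]
    rintro _ ⟨⟨i, l⟩, rfl⟩
    exact T.entry_mem_gaussImageField i l

end GaussField

end ProjectiveVariety

/-! ### The tangent spaces of the closure of a point -/

section Equations

variable {k L : Type*} [Field k] [Field L] [Algebra k L]

/-- A separable algebraic equation for `t j` over `k(t ∘ J)`, made homogeneous. -/
theorem exists_homogeneous_equation {σ τ : Type*} [Fintype σ] {t : τ → L} {J : σ → τ} {i₀ : σ}
    (ht : t (J i₀) = 1)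
    [Algebra.IsSeparable (IntermediateField.adjoin k (Set.range (t ∘ J))) L] {j : τ}
    (hj : j ∉ Set.range J) :
    ∃ (d : ℕ) (F : MvPolynomial τ k), F.IsHomogeneous d ∧ aeval t F = 0 ∧
      (∀ l ∉ Set.range J, l ≠ j → pderiv l F = 0) ∧ aeval t (pderiv j F) ≠ 0 := by
  classical
  let E := IntermediateField.adjoin k (Set.range (t ∘ J))
  let P := minpoly E (t j)
  let D := P.natDegree
  obtain ⟨d, q, A, -, hq0, hA⟩ := exists_common_denominator (k := k) (t := t ∘ J) (i₀ := i₀) ht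
    (u := fun i : Fin (D + 1) => (P.coeff i : L)) fun i => (P.coeff i).2
  have hA' : ∀ i, aeval t (rename J (A i)) = (P.coeff i : L) * aeval (t ∘ J) q := fun i => by
    rw [aeval_rename]; exact (hA i).2
  have hvars : ∀ l ∉ Set.range J, ∀ i, pderiv l (rename J (A i)) = 0 := fun l hl i =>
    pderiv_eq_zero_of_notMem_vars fun h => hl (by
      obtain ⟨m, -, hm⟩ := Finset.mem_image.1 (vars_rename J (A i) h)
      exact ⟨m, hm⟩)
  have hX : ∀ l ∉ Set.range J, pderiv l (X (J i₀) : MvPolynomial τ k) = 0 := fun l hl =>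
    pderiv_X_of_ne fun h => hl ⟨i₀, h⟩
  -- clear denominators in the minimal polynomial, and homogenize with the coordinate of value `1`
  refine ⟨d + D, ∑ i : Fin (D + 1), rename J (A i) * (X (J i₀) ^ (D - i) * X j ^ (i : ℕ)),
    IsHomogeneous.sum _ _ _ fun i _ => ?_, ?_, fun l hl hlj => ?_, ?_⟩
  · have h1 := (hA i).1.rename_isHomogeneous (f := J)
    have h2 := (isHomogeneous_X_pow (R := k) (J i₀) (D - i)).mul
      (isHomogeneous_X_pow (R := k) j (i : ℕ))
    rw [Nat.sub_add_cancel (Nat.lt_succ_iff.1 i.2)] at h2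
    exact h1.mul h2
  · simp only [map_sum, map_mul, map_pow, aeval_X, ht, one_pow, one_mul, hA']
    have h1 := minpoly.aeval E (t j)
    rw [Polynomial.aeval_eq_sum_range, ← Fin.sum_univ_eq_sum_range
      (fun i => P.coeff i • t j ^ i)] at h1
    calc _ = (∑ i : Fin (D + 1), P.coeff i • t j ^ (i : ℕ)) * aeval (t ∘ J) q := by
          rw [Finset.sum_mul]
          refine Finset.sum_congr rfl fun i _ => ?_
          change _ = (P.coeff i : L) * t j ^ (i : ℕ) * _
          ring
      _ = 0 := by rw [h1, zero_mul]
  · rw [map_sum]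
    refine Finset.sum_eq_zero fun i _ => ?_
    simp [hvars l hl, hX l hl, pderiv_X_of_ne hlj.symm]
  · have h1 : Polynomial.aeval (t j) (Polynomial.derivative P) ≠ 0 :=
      (Algebra.IsSeparable.isSeparable E (t j)).aeval_derivative_ne_zero (minpoly.aeval E (t j))
    have h2 : Polynomial.aeval (t j) (Polynomial.derivative P) =
        ∑ i : Fin (D + 1), (P.coeff i : L) * i * t j ^ ((i : ℕ) - 1) := by
      conv_lhs => rw [P.as_sum_range]
      rw [← Fin.sum_univ_eq_sum_range (fun i => Polynomial.monomial i (P.coeff i)), map_sum,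
        map_sum]
      refine Finset.sum_congr rfl fun i _ => ?_
      rw [Polynomial.derivative_monomial, Polynomial.aeval_monomial, map_mul (algebraMap E L),
        _root_.map_natCast (algebraMap E L)]
      rfl
    have h3 : aeval t (pderiv j (∑ i : Fin (D + 1),
        rename J (A i) * (X (J i₀) ^ (D - i) * X j ^ (i : ℕ)))) =
        Polynomial.aeval (t j) (Polynomial.derivative P) * aeval (t ∘ J) q := by
      rw [h2, map_sum, map_sum, Finset.sum_mul]
      refine Finset.sum_congr rfl fun i _ => ?_
      simp only [pderiv_mul, pderiv_pow, hvars j hj, hX j hj, pderiv_X_self, map_mul, map_add,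
        map_pow, hA', aeval_X, ht, one_pow, map_zero, map_natCast, map_one]
      ring
    rw [h3]
    exact mul_ne_zero h1 hq0

end Equations

namespace ProjectiveVariety

variable {k L : Type*} [Field k] [Field L] [Algebra k L] {N : ℕ} {t : Fin (N + 1) → L}
  (ht : t 0 = 1)

/-- The tangent frame of the closure of a point `t`, from the matrix `b` of the tangent space at the
generic point. -/
theorem exists_tangentFrame (htop : IntermediateField.adjoin k (Set.range t) = ⊤) {r : ℕ}
    {J : Fin r → Fin (N + 1)} {i₀ : Fin r} (hi₀ : J i₀ = 0)
    [Algebra.IsSeparable (IntermediateField.adjoin k (Set.range (t ∘ J))) L]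
    {b : Fin r → Fin (N + 1) → L} (hbJ : ∀ i l, b i (J l) = if i = l then 1 else 0)
    (htan : ∀ (i : Fin r) (d : ℕ) (F : MvPolynomial (Fin (N + 1)) k), F.IsHomogeneous d →
      aeval t F = 0 → ∑ l, aeval t (pderiv l F) * b i l = 0) :
    ∃ T : TangentFrame (ofPoint t ht : ProjectiveVariety k N) r,
      ∀ i l, functionFieldEquiv ht htop (T.entry i l) = b i l := by
  let X : ProjectiveVariety k N := ofPoint t ht
  -- where `g j ≠ 0`, the equation for `t j` determines `v j` for a tangent vector `v`
  have hg : ∀ j, ∃ (e : ℕ) (g : MvPolynomial (Fin (N + 1)) k), g.IsHomogeneous e ∧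
      aeval t g ≠ 0 ∧ ∀ x ∈ X.points, eval x.rep g ≠ 0 → ∀ v ∈ X.tangentSpace x,
        (∀ i, v (J i) = 0) → v j = 0 := by
    intro j
    by_cases hj : j ∈ Set.range J
    · obtain ⟨i, rfl⟩ := hj
      exact ⟨0, 1, isHomogeneous_one _ _, by simp, fun x _ _ v _ hv => hv i⟩
    · obtain ⟨d, F, hF, hF0, hFl, hFj⟩ := exists_homogeneous_equation (k := k) (t := t) (J := J)
        (i₀ := i₀) (by rw [hi₀, ht]) hj
      refine ⟨d - 1, pderiv j F, hF.pderiv, hFj, fun x _ hx v hv hvJ => ?_⟩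
      have h1 := hv F ((mem_ideal_ofPoint_iff ht hF).2 hF0)
      rw [Finset.sum_eq_single j] at h1
      · exact (mul_eq_zero.1 h1).resolve_left hx
      · intro l _ hlj
        by_cases hl : l ∈ Set.range J
        · obtain ⟨i, rfl⟩ := hl
          rw [hvJ, mul_zero]
        · rw [hFl l hl hlj, map_zero, zero_mul]
      · simp
  choose e g hge hg0 hg using hg
  obtain ⟨d, q, A, hq, hq0, hA⟩ := exists_common_denominator (k := k) ht
    (u := fun il : Fin r × Fin (N + 1) => b il.1 il.2) fun _ => htop ▸ IntermediateField.mem_top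
  have hG : (∏ j, g j).IsHomogeneous (∑ j, e j) := IsHomogeneous.prod _ _ _ fun j _ => hge j
  have hG0 : aeval t (∏ j, g j) ≠ 0 := by
    rw [map_prod]; exact Finset.prod_ne_zero_iff.2 fun j _ => hg0 j
  have hqG0 : aeval t (q * ∏ j, g j) ≠ 0 := by
    rw [map_mul]; exact mul_ne_zero hq0 hG0
  have hβ : ∀ i l, (A (i, l) * ∏ j, g j).IsHomogeneous (d + ∑ j, e j) := fun i l =>
    (hA (i, l)).1.mul hG
  have hβt : ∀ i l, aeval t (A (i, l) * ∏ j, g j) = b i l * aeval t (q * ∏ j, g j) := fun i l => by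
    rw [map_mul, (hA (i, l)).2, map_mul, mul_assoc]
  let T : TangentFrame X r :=
    { J := J
      d := d + ∑ j, e j
      q := q * ∏ j, g j
      β := fun i l => A (i, l) * ∏ j, g j
      q_isHomogeneous := hq.mul hG
      β_isHomogeneous := hβ
      q_notMem := fun h => hqG0 ((mem_ideal_ofPoint_iff ht (hq.mul hG)).1 h)
      β_sub_mem := fun i l => by
        have h1 : (if i = l then q * ∏ j, g j else 0).IsHomogeneous (d + ∑ j, e j) := by
          split_ifs
          exacts [hq.mul hG, isHomogeneous_zero _ _ _]
        refine (mem_ideal_ofPoint_iff ht ((hβ i (J l)).sub h1)).2 ?_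
        rw [map_sub, hβt, hbJ]
        split_ifs <;> simp
      tangent_mem := fun i F hF => by
        have h1 : ∑ l, pderiv l F * (A (i, l) * ∏ j, g j) =
            ∑ m ∈ Finset.range (F.totalDegree + 1),
              ∑ l, pderiv l (homogeneousComponent m F) * (A (i, l) * ∏ j, g j) := by
          rw [Finset.sum_comm]
          refine Finset.sum_congr rfl fun l _ => ?_
          conv_lhs => rw [← sum_homogeneousComponent F]
          rw [map_sum, Finset.sum_mul]
        rw [h1]
        refine Ideal.sum_mem _ fun m _ => ?_
        have h2 := homogeneousComponent_isHomogeneous m F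
        have h3 := (mem_ideal_ofPoint_iff ht h2).1 (X.homogeneousComponent_mem_ideal hF m)
        refine (mem_ideal_ofPoint_iff ht
          (IsHomogeneous.sum _ _ _ fun l _ => h2.pderiv.mul (hβ i l))).2 ?_
        have h4 : ∀ l, aeval t (pderiv l (homogeneousComponent m F) * (A (i, l) * ∏ j, g j)) =
            aeval t (pderiv l (homogeneousComponent m F)) * b i l * aeval t (q * ∏ j, g j) :=
          fun l => by rw [map_mul, hβt, mul_assoc]
        rw [map_sum, Finset.sum_congr rfl fun l _ => h4 l, ← Finset.sum_mul,
          htan i m _ h2 h3, zero_mul]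
      eq_zero_of_mem_tangentSpace := fun x hx hqx v hv hvJ => by
        rw [map_mul, map_prod, mul_ne_zero_iff, Finset.prod_ne_zero_iff] at hqx
        exact funext fun j => hg j x hx (hqx.2 j (Finset.mem_univ j)) v hv hvJ }
  refine ⟨T, fun i l => ?_⟩
  rw [functionFieldEquiv_apply ht htop (hβ i l) (hq.mul hG) (T.entry i l) rfl, hβt,
    mul_div_cancel_right₀ _ hqG0]

/-- The function field of the Gauss image of the closure of a point `t` is generated by the entries
of the reduced matrix of its tangent space. -/
theorem map_gaussImageField_ofPoint [IsAlgClosed k]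
    (htop : IntermediateField.adjoin k (Set.range t) = ⊤) {r : ℕ}
    (hr : (ofPoint t ht : ProjectiveVariety k N).dim + 1 = r)
    {J : Fin r → Fin (N + 1)} {i₀ : Fin r} (hi₀ : J i₀ = 0)
    [Algebra.IsSeparable (IntermediateField.adjoin k (Set.range (t ∘ J))) L]
    {b : Fin r → Fin (N + 1) → L} (hbJ : ∀ i l, b i (J l) = if i = l then 1 else 0)
    (htan : ∀ (i : Fin r) (d : ℕ) (F : MvPolynomial (Fin (N + 1)) k), F.IsHomogeneous d →
      aeval t F = 0 → ∑ l, aeval t (pderiv l F) * b i l = 0) :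
    (ofPoint t ht : ProjectiveVariety k N).gaussImageField.map
        (functionFieldEquiv ht htop : _ →ₐ[k] L) =
      IntermediateField.adjoin k (Set.range fun il : Fin r × Fin (N + 1) => b il.1 il.2) := by
  subst hr
  obtain ⟨T, hT⟩ := exists_tangentFrame ht htop hi₀ hbJ htan
  rw [T.gaussImageField_eq, IntermediateField.adjoin_map, ← Set.range_comp]
  congr 2
  funext il
  exact hT il.1 il.2

end ProjectiveVariety

/-! ### Construction of the variety -/

section Existence

/-- A linearly independent family can be prolonged to any length by members of a sequence which
spans an infinite dimensional space. -/
theorem LinearIndependent.exists_extension {k M : Type*} [Field k] [AddCommGroup M] [Module k M]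
    {a : ℕ} {v : Fin a → M} (hv : LinearIndependent k v) {f : ℕ → M}
    (hf : LinearIndependent k f) {m : ℕ} (h : a ≤ m) :
    ∃ w : Fin m → M, LinearIndependent k w ∧ (∀ i, w (Fin.castLE h i) = v i) ∧
      ∀ j, j ∈ Set.range (Fin.castLE h) ∨ ∃ c, w j = f c := by
  induction m, h using Nat.le_induction with
  | base => exact ⟨v, hv, fun i => rfl, fun j => Or.inl ⟨j, rfl⟩⟩
  | succ m h ih =>
    obtain ⟨w, hw, hwv, hwf⟩ := ih
    obtain ⟨c, hc⟩ : ∃ c, f c ∉ Submodule.span k (Set.range w) := by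
      by_contra! hc
      have : FiniteDimensional k (Submodule.span k (Set.range w)) :=
        FiniteDimensional.span_of_finite k (Set.finite_range w)
      have h1 : LinearIndependent k
          (fun c => (⟨f c, hc c⟩ : Submodule.span k (Set.range w))) :=
        LinearIndependent.of_comp (Submodule.subtype _) hf
      exact not_finite_iff_infinite.2 inferInstance h1.finite
    refine ⟨Fin.snoc w (f c), linearIndependent_finSnoc.2 ⟨hw, hc⟩, fun i => ?_, fun j => ?_⟩
    · have h1 : Fin.castLE (h.trans m.le_succ) i = (Fin.castLE h i).castSucc := rfl
      rw [h1, Fin.snoc_castSucc, hwv]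
    · induction j using Fin.lastCases with
      | last => exact Or.inr ⟨c, Fin.snoc_last _ _⟩
      | cast j =>
        rw [Fin.snoc_castSucc]
        refine (hwf j).imp ?_ id
        rintro ⟨i, rfl⟩
        exact ⟨i, rfl⟩

theorem Transcendental.linearIndependent_pow {k A : Type*} [Field k] [CommRing A] [Algebra k A]
    {y : A} (hy : Transcendental k y) : LinearIndependent k fun c : ℕ => y ^ c := by
  have h := (Polynomial.basisMonomials k).linearIndependent.map'
    (Polynomial.aeval (R := k) y).toLinearMap
    (LinearMap.ker_eq_bot.2 (transcendental_iff_injective.1 hy))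
  have h1 : (fun c : ℕ => y ^ c) =
      (Polynomial.aeval (R := k) y).toLinearMap ∘ Polynomial.basisMonomials k :=
    funext fun c => by simp
  exact h1 ▸ h

variable {k L : Type*} [Field k] [Field L] [Algebra k L]

/-- If the Legendre transform of `φ` does not have constant coordinates only, then `1, x, φ` are
linearly independent over `k`: otherwise `φ` would be an affine linear function of `x`. -/
theorem linearIndependent_snoc_cons_one {n : ℕ} {x : Fin n → L} {φ : L}
    {δ : Fin n → Derivation k L L} (hδ : ∀ i j, δ i (x j) = if i = j then 1 else 0)
    (hne : IntermediateField.adjoin k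
      (insert (φ - ∑ i, x i * δ i φ) (Set.range fun i => δ i φ)) ≠ ⊥) :
    LinearIndependent k (Fin.snoc (Fin.cons 1 x : Fin (n + 1) → L) φ : Fin (n + 2) → L) := by
  rw [linearIndependent_finSnoc, linearIndependent_finCons]
  have hsum : ∀ (c : Fin n → k) i, δ i (∑ j, c j • x j) = algebraMap k L (c i) := by
    intro c i
    simp [map_sum, hδ, Algebra.smul_def]
  refine ⟨⟨Fintype.linearIndependent_iff.2 fun c hc i => ?_, fun h => ?_⟩, fun h => hne ?_⟩
  · have := hsum c i
    rw [hc, map_zero] at this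
    exact (algebraMap k L).injective (by rw [← this, map_zero])
  · obtain ⟨c, hc⟩ := (Submodule.mem_span_range_iff_exists_fun k).1 h
    have h0 : ∀ i, c i = 0 := fun i => by
      have := hsum c i
      rw [hc, Derivation.map_one_eq_zero] at this
      exact (algebraMap k L).injective (by rw [← this, map_zero])
    simp [h0] at hc
  · obtain ⟨c, hc⟩ := (Submodule.mem_span_range_iff_exists_fun k).1 h
    rw [Fin.sum_univ_succ] at hc
    simp only [Fin.cons_zero, Fin.cons_succ] at hc
    have h1 : ∀ i, δ i φ = algebraMap k L (c i.succ) := fun i => by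
      rw [← hc, map_add, hsum, Derivation.map_smul, Derivation.map_one_eq_zero, smul_zero, zero_add]
    rw [← le_bot_iff, IntermediateField.adjoin_le_iff, Set.insert_subset_iff]
    constructor
    · refine IntermediateField.mem_bot.2 ⟨c 0, ?_⟩
      simp only [h1]
      rw [← hc, Algebra.algebraMap_eq_smul_one, eq_sub_iff_add_eq]
      congr 1
      exact Finset.sum_congr rfl fun i _ => by rw [Algebra.smul_def, mul_comm]
    · rintro _ ⟨i, rfl⟩
      exact IntermediateField.mem_bot.2 ⟨_, (h1 i).symm⟩

/-- The rows of the matrix of the tangent space to the cone over the graph of `t`, in the chart with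
coordinates `x`: the derivatives of `t` with respect to `x`, and the value of the affine
linear approximation of `t` at `x = 0`. -/
noncomputable def tangentMatrix {n : ℕ} {τ : Type*} (x : Fin n → L)
    (δ : Fin n → Derivation k L L) (t : τ → L) : Fin (n + 1) → τ → L :=
  Fin.cons (fun l => t l - ∑ i, x i * δ i (t l)) fun i l => δ i (t l)

/-- The rows are tangent to the cone: the derivatives by the chain rule, and `t` itself by Euler's
identity. -/
theorem sum_pderiv_mul_tangentMatrix {n : ℕ} {τ : Type*} [Fintype τ] (x : Fin n → L)
    (δ : Fin n → Derivation k L L) (t : τ → L) (i : Fin (n + 1)) {d : ℕ} {F : MvPolynomial τ k}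
    (hF : F.IsHomogeneous d) (h0 : aeval t F = 0) :
    ∑ l, aeval t (pderiv l F) * tangentMatrix x δ t i l = 0 := by
  have h1 : ∀ i, ∑ l, aeval t (pderiv l F) * δ i (t l) = 0 := fun i => by
    rw [← Derivation.apply_aeval, h0, map_zero]
  induction i using Fin.cases with
  | succ i => exact h1 i
  | zero =>
    have h2 := congrArg (aeval t) hF.sum_X_mul_pderiv
    simp only [map_sum, map_mul, aeval_X, map_nsmul, h0, smul_zero] at h2
    simp only [tangentMatrix, Fin.cons_zero, mul_sub, Finset.sum_sub_distrib, Finset.mul_sum]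
    rw [Finset.sum_comm, Finset.sum_congr rfl fun l _ => mul_comm _ (t l), h2, zero_sub,
      neg_eq_zero]
    refine Finset.sum_eq_zero fun i _ => ?_
    simp only [mul_left_comm _ (x i)]
    rw [← Finset.mul_sum, h1, mul_zero]

end Existence

theorem theorem1p2 {k : Type*} [Field k] [IsAlgClosed k] (p : ℕ) [CharP k p] (hp : 0 < p)
    (K L : Type*) [Field K] [Field L] [Algebra k K] [Algebra K L] [Algebra k L]
    [IsScalarTower k K L]
    (hK : (⊤ : IntermediateField k K).FG) (hL : (⊤ : IntermediateField k L).FG)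
    (hinsep : ¬ IsSeparablyGenerated K L)
    (htr : 1 ≤ Algebra.trdeg k K)
    (n : ℕ) (hn : Algebra.trdeg k L = n) (N : ℕ) (hN : n < N)
    (hr : 3 ≤ p ∨ Even (deltaRank k K L)) :
    ∃ X : ProjectiveVariety k N, X.dim = n ∧ X.IsNondegenerate ∧
      ∃ e : X.functionField ≃ₐ[k] L,
        X.gaussImageField.map (e : X.functionField →ₐ[k] L) =
          (IsScalarTower.toAlgHom k K L).fieldRange := by
  have hpr : p.Prime := (CharP.char_is_prime_or_zero k p).resolve_right hp.ne'
  have : Fact p.Prime := ⟨hpr⟩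
  have : ExpChar k p := ExpChar.prime hpr
  have : CharP L p := charP_of_injective_algebraMap (algebraMap k L).injective p
  have : Algebra.EssFiniteType k K := IntermediateField.fg_top_iff.1 hK
  have : Algebra.EssFiniteType k L := IntermediateField.fg_top_iff.1 hL
  have hr' : (2 : k) ≠ 0 ∨ Even (deltaRank k K L) := by
    refine hr.imp_left fun h3 h2 => ?_
    have h4 : ((2 : ℕ) : k) = 0 := by exact_mod_cast h2
    exact absurd (Nat.le_of_dvd two_pos ((CharP.cast_eq_zero_iff k p 2).1 h4)) (by omega)
  obtain ⟨x, φ, δ, hx, hδ, htop, hφK⟩ := exists_legendre_coordinates p hinsep n hn hr'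
  obtain ⟨s, hs⟩ : ∃ s : K, Transcendental k s := by
    exact Algebra.transcendental_def.1 (trdeg_ne_zero_iff.1 (zero_lt_one.trans_le htr).ne')
  -- all derivations kill the powers of `y`, which serve as the coordinates after `φ`
  let y : K := s ^ p
  have hy : Transcendental k (algebraMap K L y) :=
    (transcendental_algebraMap_iff (algebraMap K L).injective).2 (hs.pow hp)
  have hyD : ∀ (D : Derivation k L L) (c : ℕ), D (algebraMap K L y ^ c) = 0 := fun D c => by
    rw [Derivation.leibniz_pow, map_pow, Derivation.leibniz_pow]
    simp
  have hyK : ∀ c : ℕ, algebraMap K L y ^ c ∈ (IsScalarTower.toAlgHom k K L).fieldRange :=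
    fun c => ⟨y ^ c, map_pow _ _ _⟩
  have hli := linearIndependent_snoc_cons_one hδ (φ := φ) fun hbot => by
    have h1 := hyK 1
    rw [← hφK, hbot, pow_one] at h1
    obtain ⟨c, hc⟩ := IntermediateField.mem_bot.1 h1
    exact hy (hc ▸ isAlgebraic_algebraMap c)
  have hle : n + 2 ≤ N + 1 := by omega
  obtain ⟨t, ht, htv, htf⟩ := hli.exists_extension hy.linearIndependent_pow hle
  let J : Fin (n + 1) → Fin (N + 1) := fun i => Fin.castLE hle i.castSucc
  have htJ0 : t (J 0) = 1 := by
    rw [htv, Fin.snoc_castSucc, Fin.cons_zero]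
  have htJ : ∀ i : Fin n, t (J i.succ) = x i := fun i => by
    rw [htv, Fin.snoc_castSucc, Fin.cons_succ]
  have htφ : t (Fin.castLE hle (Fin.last _)) = φ := by
    rw [htv, Fin.snoc_last]
  have hJ0 : J 0 = 0 := rfl
  have ht0 : t 0 = 1 := htJ0
  have httop : IntermediateField.adjoin k (Set.range t) = ⊤ := by
    rw [eq_top_iff, ← htop, IntermediateField.adjoin_le_iff, Set.insert_subset_iff]
    constructor
    · exact IntermediateField.subset_adjoin _ _ ⟨_, htφ⟩
    · rintro _ ⟨i, rfl⟩
      exact IntermediateField.subset_adjoin _ _ ⟨_, htJ i⟩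
  have hsep : Algebra.IsSeparable (IntermediateField.adjoin k (Set.range (t ∘ J))) L :=
    (isSeparable_adjoin_iff_forall_derivation _).2 fun D hD =>
      hx D fun i => by rw [← htJ]; exact hD i.succ
  let b := tangentMatrix x δ t
  have hbJ : ∀ i l, b i (J l) = if i = l then 1 else 0 := by
    intro i l
    induction l using Fin.cases with
    | zero =>
      induction i using Fin.cases with
      | zero => simp [b, tangentMatrix, htJ0]
      | succ i => simp [b, tangentMatrix, htJ0]
    | succ l =>
      induction i using Fin.cases with
      | zero => simp [b, tangentMatrix, htJ, hδ, (Fin.succ_ne_zero l).symm]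
      | succ i => simp [b, tangentMatrix, htJ, hδ]
  have hb : IntermediateField.adjoin k (Set.range fun il : Fin (n + 1) × Fin (N + 1) =>
      b il.1 il.2) = (IsScalarTower.toAlgHom k K L).fieldRange := by
    apply le_antisymm
    · rw [IntermediateField.adjoin_le_iff]
      rintro _ ⟨⟨i, l⟩, rfl⟩
      rcases htf l with ⟨l, rfl⟩ | ⟨c, hc⟩
      · induction l using Fin.lastCases with
        | cast l =>
          have h1 := hbJ i l
          simp only [J] at h1
          simp only [h1]
          split_ifs
          exacts [one_mem _, zero_mem _]
        | last =>
          rw [← hφK]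
          apply IntermediateField.subset_adjoin
          induction i using Fin.cases with
          | zero => exact Or.inl (by simp [b, tangentMatrix, htφ])
          | succ i => exact Or.inr ⟨i, by simp [b, tangentMatrix, htφ]⟩
      · induction i using Fin.cases with
        | zero => simpa [b, tangentMatrix, hc, hyD] using hyK c
        | succ i => simp [b, tangentMatrix, hc, hyD]
    · rw [← hφK, IntermediateField.adjoin_le_iff, Set.insert_subset_iff]
      constructor
      · exact IntermediateField.subset_adjoin _ _
          ⟨(0, Fin.castLE hle (Fin.last _)), by simp [b, tangentMatrix, htφ]⟩
      · rintro _ ⟨i, rfl⟩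
        exact IntermediateField.subset_adjoin _ _
          ⟨(i.succ, Fin.castLE hle (Fin.last _)), by simp [b, tangentMatrix, htφ]⟩
  have hdim := ProjectiveVariety.dim_ofPoint ht0 httop hn
  refine ⟨ProjectiveVariety.ofPoint t ht0, hdim,
    ProjectiveVariety.isNondegenerate_of_linear_notMem _ fun c hc => ?_,
    ProjectiveVariety.functionFieldEquiv ht0 httop, ?_⟩
  · have hlin : (∑ i, C (c i) * X i : MvPolynomial (Fin (N + 1)) k).IsHomogeneous 1 :=
      IsHomogeneous.sum _ _ _ fun i _ => by
        simpa using (isHomogeneous_C (Fin (N + 1)) (c i)).mul (isHomogeneous_X k i)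
    rw [ProjectiveVariety.mem_ideal_ofPoint_iff ht0 hlin] at hc
    refine funext fun i => Fintype.linearIndependent_iff.1 ht c ?_ i
    simpa [Algebra.smul_def, algebraMap_eq] using hc
  · rw [ProjectiveVariety.map_gaussImageField_ofPoint ht0 httop (by rw [hdim]) hJ0 hbJ
      fun i d F hF h0 => sum_pderiv_mul_tangentMatrix x δ t i hF h0, hb]
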